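/- Let $(K,\nu)$ be a henselian (Krull) valued field with $\operatorname{char} K=0$ and residue characteristic $\operatorname{char} K\nu=p>0$, written additively with value group $\nu K$ and residue field $K\nu$. Suppose that $K$ contains a primitive $p$-th root of unity, and let $K(\theta)|K$ be a Kummer extension with Kummer generator $\theta$, i.e. $\theta^p\in K$ and $\theta\notin K$ (so $K(\theta)|K$ is Galois of degree $p$). Equip $K(\theta)$ with the unique extension of $\nu$, and put $\nu(\theta-K)=\{\nu(\theta-c)\mid c\in K\}$. A finite extension $(L|K,\nu)$ is called immediate if $\nu L=\nu K$ and $L\nu=K\nu$; defectless if $[L:K]=[\nu L:\nu K]\,[L\nu:K\nu]$; purely wild if $\nu L/\nu K$ is a $p$-group and $L\nu|K\nu$ is purely inseparable; unramified if $\nu L=\nu K$ and for every subextension $E|K$ of $L|K$ the prime $p$ does not divide $[\nu E:\nu K]$ and $E\nu|K\nu$ is separable. Then: (I) If $\nu(\theta-K)$ has no maximal element, then $(K(\theta)|K,\nu)$ is immediate. (II) Suppose that $\nu(\theta-K)$ has a maximal element $\gamma$. (II.A) If $\gamma\notin\nu K$, then $(K(\theta)|K,\nu)$ is purely wild and defectless.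 (II.B) If $\gamma\in\nu K$, then there is a Kummer generator $\theta'$ of $K(\theta)|K$ with $\nu\theta'=0$ such that $\nu(\theta'-K)$ has a maximal element and this element lies in $\nu K$. For every such $\theta'$, with $\gamma'=\max\nu(\theta'-K)$, we have $0\le\gamma'\le\frac{\nu p}{p-1}$, and: (II.B.1) if $0\le\gamma'<\frac{\nu p}{p-1}$, then $(K(\theta)|K,\nu)$ is purely wild and defectless; (II.B.2) if $\gamma'=\frac{\nu p}{p-1}$, then $(K(\theta)|K,\nu)$ is defectless and unramified, and $K(\theta)\nu|K\nu$ is an Artin–Schreier extension, i.e. $K(\theta)\nu=K\nu(\eta)$ for some $\eta\notin K\nu$ with $\eta^p-\eta\in K\nu$. -/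

import Mathlib

open scoped IntermediateField

/-! Extensions of valued fields.  A valued field extension `(L|K, ν)` is given by a field
extension `L|K` and a valuation `v` on `L`; the field `K` carries the restriction of `v`.

Mathlib writes valuations multiplicatively: `v x` stands for the additive value `ν x` with
the order reversed.  So `ν x = 0`, `ν x ≥ 0`, `ν x < ν y` read `v x = 1`, `v x ≤ 1`, `v y < v x`,
and a maximum of values in the additive notation is a least element in the multiplicative one. -/

namespace KummerVal

section Definitions

variable {L Γ : Type*} [Field L] [LinearOrderedCommGroupWithZero Γ]

/-- The restriction to `K` of a valuation `v` on an extension field of `K`. -/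
abbrev restr (K : Type*) [Field K] [Algebra K L] (v : Valuation L Γ) : Valuation K Γ :=
  v.comap (algebraMap K L)

instance restr_hasExtension (K : Type*) [Field K] [Algebra K L] (v : Valuation L Γ) :
    (restr K v).HasExtension v :=
  ⟨Valuation.IsEquiv.refl⟩

/-- The value group of a valued field, as a subgroup of the units of `Γ`. -/
abbrev vGroup (v : Valuation L Γ) : Subgroup Γˣ :=
  MonoidWithZeroHom.valueGroup (MonoidWithZeroHom.ofClass v)

/-- The residue field of a valued field. -/
abbrev residue (v : Valuation L Γ) : Type _ :=
  IsLocalRing.ResidueField v.valuationSubring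

variable (K : Type*) [Field K] [Algebra K L] (v : Valuation L Γ)

/-- The ramification index `[νL : νK]` (with value `0` when it is infinite). -/
noncomputable def ramIdx : ℕ :=
  (vGroup (restr K v)).relIndex (vGroup v)

/-- The inertia degree `[Lν : Kν]` (with value `0` when it is infinite). -/
noncomputable def inertiaDeg : ℕ :=
  Module.finrank (residue (restr K v)) (residue v)

/-- The extension `(L|K, ν)` is immediate: `νL = νK` and `Lν = Kν`. -/
def IsImmediate : Prop :=
  vGroup v = vGroup (restr K v) ∧
    Function.Surjective (algebraMap (residue (restr K v)) (residue v))

/-- The finite extension `(L|K, ν)` is defectless: `[L : K] = [νL : νK] [Lν : Kν]`. -/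
def IsDefectless : Prop :=
  FiniteDimensional K L ∧ Module.finrank K L = ramIdx K v * inertiaDeg K v

/-- The algebraic extension `(L|K, ν)` with residue characteristic `p` is purely wild:
`νL/νK` is a `p`-group and `Lν|Kν` is purely inseparable. -/
def IsPurelyWild (p : ℕ) : Prop :=
  Algebra.IsAlgebraic K L ∧
    IsPGroup p (vGroup v ⧸ (vGroup (restr K v)).subgroupOf (vGroup v)) ∧
    IsPurelyInseparable (residue (restr K v)) (residue v)

/-- The algebraic extension `(L|K, ν)` with residue characteristic `p` is tamely ramified:
for every finite subextension `E|K`, `p` does not divide `[νE : νK]` and `Eν|Kν` is separable. -/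
def IsTamelyRamified (p : ℕ) : Prop :=
  Algebra.IsAlgebraic K L ∧
    ∀ E : IntermediateField K L, FiniteDimensional K E →
      ¬ p ∣ ramIdx K (restr E v) ∧
        Algebra.IsSeparable (residue (restr K (restr E v))) (residue (restr E v))

/-- The extension `(L|K, ν)` is unramified: it is tamely ramified and `νL = νK`. -/
def IsUnramified (p : ℕ) : Prop :=
  IsTamelyRamified K v p ∧ vGroup v = vGroup (restr K v)

/-- The set `ν(θ - K) = {ν(θ - c) | c ∈ K}`, for `θ` not in `K` (so that no value is infinite). -/
def valueSet (θ : L) : Set Γˣ :=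
  {γ | ∃ c : K, v (θ - algebraMap K L c) = (γ : Γ)}

end Definitions

/-- `θ` is a Kummer generator of `L|K`: it is a root of some `X ^ p - a` with `a` in `K`, does not
lie in `K`, and `L = K(θ)`.  (Used for `K` of characteristic `0` containing a primitive `p`-th root
of unity, `p` prime; then `L|K` is Galois of degree `p` and `X ^ p - a` is the minimal polynomial
of `θ`.) -/
def IsKummerGenerator (p : ℕ) (K : Type*) {L : Type*} [Field K] [Field L] [Algebra K L]
    (θ : L) : Prop :=
  (∃ a : K, θ ^ p = algebraMap K L a) ∧ (∀ c : K, θ ≠ algebraMap K L c) ∧ K⟮θ⟯ = ⊤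

/-- The field extension `l|k` in characteristic `p` is an Artin-Schreier extension: it is generated
by a root `η ∉ k` of some Artin-Schreier polynomial `X ^ p - X - a` over `k`. -/
def IsArtinSchreierExtension (p : ℕ) (k l : Type*) [Field k] [Field l] [Algebra k l] : Prop :=
  CharP k p ∧ ∃ η : l, (∃ a : k, η ^ p - η = algebraMap k l a) ∧
    (∀ c : k, η ≠ algebraMap k l c) ∧ k⟮η⟯ = ⊤

end KummerVal

/-! Henselianity forces all conjugates in the Galois extension of degree `p` to have the same value
(`map_algEquiv_eq`), so the Galois group acts on residues. Suppose some `x` has value outside νK, or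
is integral with residue outside Kν. Then the class of its value has order `p`, or its residue has
degree `p`, and `1, x, …, x ^ (p - 1)` form a valuation basis of `L` over `K`. Hence the extension
is defectless, and if θ = ∑ cᵢ xⁱ then c₀ is a best approximation of θ in `K`. So if no best
approximation exists, the extension is immediate. Conversely, a best approximation `c` produces such
an `x`: take θ - c if γ ∉ νK, and (θ - c)/d with ν d = γ otherwise. In the second case a residue in
Kν would lead to an improvement of `c`. It remains to see how the group acts on this new residue
when ν θ = 0. Let σθ = ζθ, so that σx - x = (ζ - 1)θ/d, where ν(ζ - 1) = ν p/(p - 1). From (1 - ζ)θ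
= (θ - c) - σ(θ - c) comes γ ≤ ν(ζ - 1). If the inequality is strict, σ fixes the residue, whose
`p`-th power then lies in Kν: purely inseparable. If equality holds, d = c(ζ - 1) gives σx ≡ x + 1,
and the residues of the conjugates are the roots of an Artin-Schreier polynomial. -/

namespace KummerVal

open Polynomial

/-! ### Value groups as sets of values -/

section ValueGroups

variable {L Γ : Type*} [Field L] [LinearOrderedCommGroupWithZero Γ]

lemma mem_vGroup_iff (v : Valuation L Γ) {γ : Γˣ} : γ ∈ vGroup v ↔ ∃ x : L, v x = γ := by
  constructor
  · intro h
    obtain ⟨a, ha, x, hx⟩ := (MonoidWithZeroHom.mem_valueGroup_iff_of_comm _).1 h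
    have ha' : v a ≠ 0 := ha
    have hx' : v a * γ = v x := hx
    exact ⟨a⁻¹ * x, by rw [map_mul, map_inv₀, ← hx', inv_mul_cancel_left₀ ha']⟩
  · rintro ⟨x, hx⟩
    exact MonoidWithZeroHom.mem_valueGroup _ ⟨x, hx⟩

variable (K : Type*) [Field K] [Algebra K L] (v : Valuation L Γ)

lemma mem_vGroup_restr_iff {γ : Γˣ} :
    γ ∈ vGroup (restr K v) ↔ ∃ c : K, v (algebraMap K L c) = γ := by
  rw [mem_vGroup_iff]; rfl

lemma vGroup_restr_le : vGroup (restr K v) ≤ vGroup v := by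
  intro γ h
  obtain ⟨c, hc⟩ := (mem_vGroup_restr_iff K v).1 h
  exact (mem_vGroup_iff v).2 ⟨_, hc⟩

end ValueGroups

/-! ### Conjugates over a henselian field have equal values -/

section Conjugates

variable {K L Γ : Type*} [Field K] [Field L] [Algebra K L] [LinearOrderedCommGroupWithZero Γ]
  (v : Valuation L Γ) [FiniteDimensional K L] [IsGalois K L]

/-- An element all of whose conjugates are integral is a root of a monic polynomial with integral
coefficients that splits into the factors given by the conjugates. -/
lemma exists_monic_map_eq_prod_conjugates {x : L} (hx : ∀ σ : L ≃ₐ[K] L, v (σ x) ≤ 1) :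
    ∃ Q : (restr K v).valuationSubring[X], Q.Monic ∧
      Q.map (algebraMap (restr K v).valuationSubring v.valuationSubring) =
        ∏ σ : L ≃ₐ[K] L, (X - C (⟨σ x, hx σ⟩ : v.valuationSubring)) := by
  obtain ⟨P, hP, -, hPm⟩ := lifts_and_natDegree_eq_and_monic
    (Algebra.IsInvariant.charpoly_mem_lifts K L (L ≃ₐ[K] L) x)
    (MulSemiringAction.monic_charpoly _ x)
  have key : (∏ σ : L ≃ₐ[K] L, (X - C (⟨σ x, hx σ⟩ : v.valuationSubring))).map
      (algebraMap v.valuationSubring L) = P.map (algebraMap K L) := by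
    rw [hP, MulSemiringAction.charpoly_eq, Polynomial.map_prod]
    simp only [Polynomial.map_sub, Polynomial.map_X, Polynomial.map_C]
    rfl
  have hint : ∀ z : v.valuationSubring, v (algebraMap v.valuationSubring L z) ≤ 1 := fun z => z.2
  have hlift : P ∈ Polynomial.lifts (algebraMap (restr K v).valuationSubring K) := by
    rw [Polynomial.lifts_iff_coeff_lifts]
    intro n
    have h : v (algebraMap K L (P.coeff n)) ≤ 1 := by
      rw [← Polynomial.coeff_map, ← key, Polynomial.coeff_map]
      exact hint _
    exact ⟨⟨P.coeff n, h⟩, rfl⟩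
  obtain ⟨Q, hQ, -, hQm⟩ := lifts_and_natDegree_eq_and_monic hlift hPm
  refine ⟨Q, hQm, Polynomial.map_injective (algebraMap v.valuationSubring L)
    Subtype.val_injective ?_⟩
  rw [key, ← hQ, Polynomial.map_map, Polynomial.map_map]
  rfl

/-- Over a henselian field, no element has a conjugate of strictly largest value. -/
lemma not_forall_conjugate_lt (hhens : HenselianLocalRing (restr K v).valuationSubring)
    {τ : L ≃ₐ[K] L} (hτ : τ ≠ 1) (y : L) :
    ¬ ∀ σ : L ≃ₐ[K] L, σ ≠ 1 → v (σ y) < v y := by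
  classical
  intro hy
  set t : L := algebraMap K L (Algebra.trace K L y) with ht
  have htsum : t = ∑ σ : L ≃ₐ[K] L, σ y := trace_eq_sum_automorphisms y
  have hvt : v t = v y := by
    rw [htsum]
    have := v.map_sum_eq_of_lt (s := Finset.univ) (f := fun σ : L ≃ₐ[K] L => σ y)
      (Finset.mem_univ 1) (by
        intro σ hσ
        simpa using hy σ (by simpa using hσ))
    simpa using this
  have hy0 : v y ≠ 0 := (lt_of_le_of_lt zero_le (hy τ hτ)).ne'
  have ht0 : t ≠ 0 := by
    intro h
    rw [h, map_zero] at hvt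
    exact hy0 hvt.symm
  -- Dividing by the trace makes the conjugates sum to 1, so `x` is close to 1 and its other
  -- conjugates are close to 0.
  set x : L := y / t with hxdef
  have hσx : ∀ σ : L ≃ₐ[K] L, σ x = σ y / t := by
    intro σ
    rw [hxdef, map_div₀, ht, AlgEquiv.commutes]
  have hx1 : v x = 1 := by rw [hxdef, map_div₀, hvt, div_self hy0]
  have hxlt : ∀ σ : L ≃ₐ[K] L, σ ≠ 1 → v (σ x) < 1 := by
    intro σ hσ
    rw [hσx, map_div₀, hvt, div_lt_one₀ (zero_lt_iff.2 hy0)]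
    exact hy σ hσ
  have hxle : ∀ σ : L ≃ₐ[K] L, v (σ x) ≤ 1 := by
    intro σ
    by_cases h : σ = 1
    · subst h; exact hx1.le
    · exact (hxlt σ h).le
  have hsum : ∑ σ : L ≃ₐ[K] L, σ x = 1 := by
    simp_rw [hσx]
    rw [← Finset.sum_div, ← htsum, div_self ht0]
  have h1x : v (1 - x) < 1 := by
    rw [← hsum, Finset.sum_eq_add_sum_sdiff_singleton_of_mem (Finset.mem_univ 1)]
    simp only [AlgEquiv.one_apply, add_sub_cancel_left]
    refine v.map_sum_lt one_ne_zero ?_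
    intro σ hσ
    exact hxlt σ (by simpa using hσ)
  have h1σ : ∀ σ : L ≃ₐ[K] L, σ ≠ 1 → v (1 - σ x) = 1 := by
    intro σ hσ
    have := v.map_sub_eq_of_lt_left (x := 1) (y := σ x) (by simpa using hxlt σ hσ)
    simpa using this
  obtain ⟨Q, hQm, hQ⟩ := exists_monic_map_eq_prod_conjugates v hxle
  have heval : ∀ r : (restr K v).valuationSubring,
      algebraMap K L (Q.eval r : (restr K v).valuationSubring) =
        ∏ σ : L ≃ₐ[K] L, (algebraMap K L r - σ x) := by
    intro r
    have h : algebraMap _ v.valuationSubring (Q.eval r) = _ := (Polynomial.eval_map_apply _ _).symm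
    rw [hQ] at h
    have h2 := congrArg (algebraMap v.valuationSubring L) h
    rw [Polynomial.eval_prod, map_prod] at h2
    simpa using h2
  have hderiv : algebraMap K L (Q.derivative.eval 1 : (restr K v).valuationSubring) =
        ∑ τ : L ≃ₐ[K] L, ∏ σ ∈ Finset.univ.erase τ, (1 - σ x) := by
    have h : algebraMap _ v.valuationSubring (Q.derivative.eval 1) = _ :=
      (Polynomial.eval_map_apply _ _).symm
    rw [← Polynomial.derivative_map, hQ, Polynomial.derivative_prod_finset] at h
    have h2 := congrArg (algebraMap v.valuationSubring L) h
    rw [Polynomial.eval_finsetSum, map_sum] at h2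
    simp only [eval_mul, Polynomial.eval_prod, map_mul, map_prod] at h2
    simpa using h2
  -- The reduction of `Q` is X ^ (n - 1) * (X - 1), where n is the order of the Galois group, so 1
  -- is a simple root to which Hensel's lemma applies. Its lift to `K` is a conjugate of `x`, which
  -- forces `x` into `K`.
  have hm : Q.eval 1 ∈ IsLocalRing.maximalIdeal (restr K v).valuationSubring := by
    rw [Valuation.mem_maximalIdeal_iff]
    change v (algebraMap K L _) < 1
    rw [heval, map_prod, ← Finset.mul_prod_erase _ _ (Finset.mem_univ 1)]
    rw [Finset.prod_eq_one (s := Finset.univ.erase 1)]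
    · simpa using h1x
    · intro σ hσ
      simpa using h1σ σ (by simpa using hσ)
  have hu : IsUnit (Q.derivative.eval 1) := by
    rw [← not_not (a := IsUnit _), ← mem_nonunits_iff, ← IsLocalRing.mem_maximalIdeal,
      Valuation.mem_maximalIdeal_iff]
    change ¬ v (algebraMap K L _) < 1
    have h1 : v (∏ σ ∈ Finset.univ.erase (1 : L ≃ₐ[K] L), (1 - σ x)) = 1 := by
      rw [map_prod]
      refine Finset.prod_eq_one fun σ hσ => h1σ σ (by simpa using hσ)
    have := v.map_sum_eq_of_lt (s := Finset.univ)
      (f := fun τ : L ≃ₐ[K] L => ∏ σ ∈ Finset.univ.erase τ, (1 - σ x))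
      (Finset.mem_univ 1) (by
        intro τ hτ
        rw [h1, map_prod, ← Finset.mul_prod_erase _ _ (a := 1)
          (by simpa [eq_comm] using hτ)]
        refine mul_lt_one_of_lt_of_le (by simpa using h1x) ?_
        refine Finset.prod_le_one' fun σ hσ => ?_
        exact (h1σ σ (by simp at hσ; tauto)).le)
    rw [hderiv, this, h1]
    exact lt_irrefl 1
  obtain ⟨r, hr, -⟩ := hhens.is_henselian Q hQm 1 hm hu
  have h0 := heval r
  rw [hr.eq_zero] at h0
  simp only [ZeroMemClass.coe_zero, map_zero] at h0
  obtain ⟨σ, -, hσ⟩ := Finset.prod_eq_zero_iff.1 h0.symm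
  have hxr : x = algebraMap K L r := by
    apply σ.injective
    rw [AlgEquiv.commutes]
    exact (sub_eq_zero.1 hσ).symm
  have := hxlt τ hτ
  rw [hxr, AlgEquiv.commutes, ← hxr, hx1] at this
  exact lt_irrefl _ this

/-- The valuation of a henselian field extends uniquely to a Galois extension of prime degree. -/
lemma map_algEquiv_eq {p : ℕ} (hp : p.Prime) (hdeg : Module.finrank K L = p)
    (hhens : HenselianLocalRing (restr K v).valuationSubring) (σ : L ≃ₐ[K] L) (y : L) :
    v (σ y) = v y := by
  classical
  by_contra hne
  have hcard : Fintype.card (L ≃ₐ[K] L) = p := by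
    rw [← hdeg, ← Nat.card_eq_fintype_card, IsGalois.card_aut_eq_finrank]
  -- the set of conjugates of largest value
  let S : L → Finset (L ≃ₐ[K] L) := fun u => {τ | ∀ ρ : L ≃ₐ[K] L, v (ρ u) ≤ v (τ u)}
  have hS : ∀ u τ, τ ∈ S u ↔ ∀ ρ : L ≃ₐ[K] L, v (ρ u) ≤ v (τ u) := by simp [S]
  have hSne : ∀ u, (S u).Nonempty := by
    intro u
    obtain ⟨τ, -, hτ⟩ := Finset.exists_max_image (Finset.univ : Finset (L ≃ₐ[K] L))
      (fun τ => v (τ u)) Finset.univ_nonempty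
    exact ⟨τ, (hS _ _).2 fun ρ => hτ ρ (Finset.mem_univ _)⟩
  -- Among the proper sets of maxima, one of least cardinality is chosen. A singleton contradicts
  -- `not_forall_conjugate_lt`; a larger one will turn out to be stable under translation by a
  -- generator of the group.
  have hex : ∃ n : ℕ, ∃ u, S u ≠ Finset.univ ∧ (S u).card = n := by
    refine ⟨_, y, ?_, rfl⟩
    intro h
    refine hne (le_antisymm ?_ ?_)
    · exact (hS y 1).1 (h ▸ Finset.mem_univ _) σ
    · exact (hS y σ).1 (h ▸ Finset.mem_univ _) 1
  obtain ⟨u, hu, hun⟩ := Nat.find_spec hex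
  have hmin : ∀ w, S w ≠ Finset.univ → (S u).card ≤ (S w).card := fun w hw => by
    rw [hun]; exact Nat.find_min' hex ⟨w, hw, rfl⟩
  obtain ⟨s, hs⟩ := hSne u
  have hτ : ∃ τ : L ≃ₐ[K] L, τ ≠ 1 := by
    refine ⟨σ, fun h => hne (by rw [h]; rfl)⟩
  obtain ⟨τ₀, hτ₀⟩ := hτ
  by_cases h1 : S u = {s}
  · refine not_forall_conjugate_lt v hhens hτ₀ (s u) fun ρ hρ => ?_
    by_contra hlt
    have : ρ * s ∈ S u := (hS _ _).2 fun κ => ((hS _ _).1 hs κ).trans (not_lt.1 hlt)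
    rw [h1, Finset.mem_singleton] at this
    exact hρ (by simpa using this)
  · obtain ⟨s', hs', hss'⟩ : ∃ s' ∈ S u, s' ≠ s := by
      by_contra! hcon
      exact h1 (Finset.eq_singleton_iff_unique_mem.2 ⟨hs, hcon⟩)
    -- translate so that the two sets of maxima meet in `s`
    set g := s⁻¹ * s' with hg
    have hg1 : g ≠ 1 := by
      intro h
      exact hss' (inv_mul_eq_one.1 h).symm
    have hsg : s * g = s' := by rw [hg, mul_inv_cancel_left]
    -- Both factors of τ(u · gu) are bounded by the same maximum, and both attain it at τ = s. So
    -- the product is maximal exactly where both factors are; by minimality this intersection is all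
    -- of `S u`.
    have hmem : ∀ τ, τ ∈ S (u * g u) ↔ τ ∈ S u ∧ τ * g ∈ S u := by
      intro τ
      have hbound : ∀ ρ : L ≃ₐ[K] L, v (ρ (u * g u)) ≤ v (s u) * v (s' u) := by
        intro ρ
        rw [map_mul, map_mul]
        exact mul_le_mul' ((hS _ _).1 hs ρ) ((hS _ _).1 hs' (ρ * g))
      have hsval : v (s (u * g u)) = v (s u) * v (s' u) := by
        rw [map_mul, map_mul, ← hsg]; rfl
      have hu0 : v (s u) ≠ 0 := by
        intro h0
        apply hu
        ext ρ
        simp only [Finset.mem_univ, iff_true]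
        refine (hS _ _).2 fun κ => ?_
        refine ((hS _ _).1 hs κ).trans ?_
        rw [h0]; exact zero_le
      have hs'u : v (s' u) = v (s u) := le_antisymm ((hS _ _).1 hs s') ((hS _ _).1 hs' s)
      constructor
      · intro h
        have h2 := (hS _ _).1 h s
        rw [hsval, map_mul, map_mul, hs'u] at h2
        change _ ≤ v (τ u) * v ((τ * g) u) at h2
        have ha := (hS _ _).1 hs τ
        have hb := (hS _ _).1 hs (τ * g)
        have hpos : 0 < v (s u) := zero_lt_iff.2 hu0
        constructor
        · refine (hS _ _).2 fun ρ => ((hS _ _).1 hs ρ).trans ?_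
          by_contra hlt
          exact absurd h2 (not_le.2 ((mul_le_mul_right hb _).trans_lt
            (mul_lt_mul_of_pos_right (not_le.1 hlt) hpos)))
        · refine (hS _ _).2 fun ρ => ((hS _ _).1 hs ρ).trans ?_
          by_contra hlt
          exact absurd h2 (not_le.2 ((mul_le_mul_left ha _).trans_lt
            (mul_lt_mul_of_pos_left (not_le.1 hlt) hpos)))
      · rintro ⟨ha, hb⟩
        refine (hS _ _).2 fun ρ => (hbound ρ).trans ?_
        rw [map_mul τ, map_mul v]
        exact mul_le_mul' ((hS _ _).1 ha s) ((hS _ _).1 hb s')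
    have hsub : S (u * g u) ⊆ S u := fun τ h => ((hmem τ).1 h).1
    have hne' : S (u * g u) ≠ Finset.univ := fun h =>
      hu (Finset.univ_subset_iff.1 (h ▸ hsub))
    have heq : S (u * g u) = S u := Finset.eq_of_subset_of_card_le hsub (hmin _ hne')
    have hmul : ∀ τ ∈ S u, ∀ n : ℕ, τ * g ^ n ∈ S u := by
      intro τ hτ n
      induction n with
      | zero => simpa using hτ
      | succ n ih =>
        rw [← heq] at ih
        rw [pow_succ, ← mul_assoc]
        exact ((hmem _).1 ih).2
    apply hu
    ext τ
    simp only [Finset.mem_univ, iff_true]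
    have : Fact p.Prime := ⟨hp⟩
    obtain ⟨n, hn⟩ := mem_powers_of_prime_card (p := p) (g := g) (g' := s⁻¹ * τ)
      (by rw [Nat.card_eq_fintype_card, hcard]) hg1
    have := hmul s hs n
    rwa [show g ^ n = s⁻¹ * τ from hn, mul_inv_cancel_left] at this

end Conjugates

/-! ### Reduction of polynomials and valuation bases from residues -/

section Residues

variable {K L Γ : Type*} [Field K] [Field L] [Algebra K L] [LinearOrderedCommGroupWithZero Γ]
  (v : Valuation L Γ)

lemma residue_eq_zero_iff (v : Valuation L Γ) (x : v.valuationSubring) :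
    IsLocalRing.residue v.valuationSubring x = 0 ↔ v (x : L) < 1 := by
  rw [IsLocalRing.residue_eq_zero_iff, Valuation.mem_maximalIdeal_iff]

lemma residue_eq_iff (v : Valuation L Γ) (x y : v.valuationSubring) :
    IsLocalRing.residue v.valuationSubring x = IsLocalRing.residue v.valuationSubring y ↔
      v ((x : L) - y) < 1 := by
  rw [← sub_eq_zero, ← map_sub, residue_eq_zero_iff]; rfl

lemma residue_eval_map (x : v.valuationSubring) (R : (restr K v).valuationSubring[X]) :
    IsLocalRing.residue v.valuationSubring
        ((R.map (algebraMap (restr K v).valuationSubring v.valuationSubring)).eval x) =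
      aeval (IsLocalRing.residue v.valuationSubring x)
        (R.map (IsLocalRing.residue (restr K v).valuationSubring)) := by
  rw [aeval_def, eval_map, eval₂_map, hom_eval₂]
  rfl

lemma coe_eval_map (x : v.valuationSubring) (R : (restr K v).valuationSubring[X]) :
    (((R.map (algebraMap (restr K v).valuationSubring v.valuationSubring)).eval x :
        v.valuationSubring) : L) =
      aeval (x : L) (R.map (algebraMap (restr K v).valuationSubring K)) := by
  rw [aeval_def, eval_map, eval₂_map]
  exact hom_eval₂ R (algebraMap (restr K v).valuationSubring v.valuationSubring)
    (algebraMap v.valuationSubring L) x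

/-- A nonzero polynomial is a constant times an integral polynomial with nonzero reduction. -/
lemma exists_eq_C_mul_map {R : K[X]} (hR : R ≠ 0) :
    ∃ (c : K) (R₀ : (restr K v).valuationSubring[X]), c ≠ 0 ∧
      R = C c * R₀.map (algebraMap (restr K v).valuationSubring K) ∧
      R₀.map (IsLocalRing.residue (restr K v).valuationSubring) ≠ 0 ∧
      R₀.natDegree = R.natDegree := by
  -- Dividing by a coefficient of largest value makes the polynomial integral, with one coefficient
  -- equal to 1.
  obtain ⟨m, hm, hmax⟩ := Finset.exists_max_image R.support
    (fun i => restr K v (R.coeff i)) (by simpa using hR)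
  have hc : R.coeff m ≠ 0 := by simpa using hm
  have hvc : restr K v (R.coeff m) ≠ 0 := by simpa using hc
  have hle : ∀ i, restr K v (R.coeff i) ≤ restr K v (R.coeff m) := by
    intro i
    by_cases h : R.coeff i = 0
    · rw [h, map_zero]; exact zero_le
    · exact hmax i (by simpa using h)
  have hlift : C (R.coeff m)⁻¹ * R ∈
      Polynomial.lifts (algebraMap (restr K v).valuationSubring K) := by
    rw [Polynomial.lifts_iff_coeff_lifts]
    intro i
    have : restr K v ((C (R.coeff m)⁻¹ * R).coeff i) ≤ 1 := by
      rw [coeff_C_mul, map_mul, map_inv₀, inv_mul_le_one₀ (zero_lt_iff.2 hvc)]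
      exact hle i
    exact ⟨⟨_, this⟩, rfl⟩
  obtain ⟨R₀, hR₀⟩ := hlift
  have hR₀' : R₀.map (algebraMap (restr K v).valuationSubring K) = C (R.coeff m)⁻¹ * R := hR₀
  refine ⟨R.coeff m, R₀, hc, ?_, ?_, ?_⟩
  · rw [hR₀', ← mul_assoc, ← C_mul, mul_inv_cancel₀ hc, C_1, one_mul]
  · intro h0
    have h1 : R₀.coeff m = 1 := by
      apply Subtype.val_injective
      change algebraMap (restr K v).valuationSubring K (R₀.coeff m) = 1
      rw [← coeff_map, hR₀', coeff_C_mul, inv_mul_cancel₀ hc]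
    have := congrArg (fun P => P.coeff m) h0
    simp only [coeff_map, h1, map_one, coeff_zero, one_ne_zero] at this
  · rw [← natDegree_map_eq_of_injective
      (f := algebraMap (restr K v).valuationSubring K) Subtype.val_injective, hR₀',
      natDegree_C_mul (inv_ne_zero hc)]

/-- If the residue of `x` has degree at least `n` over the residue field of `K`, then polynomials
of degree below `n` take at `x` the largest of the values of their coefficients. -/
lemma exists_map_aeval_eq {n : ℕ} (x : v.valuationSubring)
    (hn : n ≤ (minpoly (residue (restr K v)) (IsLocalRing.residue v.valuationSubring x)).natDegree)
    {R : K[X]} (hR : R ≠ 0) (hdeg : R.natDegree < n) :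
    ∃ (c : K) (R₀ : (restr K v).valuationSubring[X]),
      R = C c * R₀.map (algebraMap (restr K v).valuationSubring K) ∧
      v (aeval (x : L) R) = v (algebraMap K L c) := by
  obtain ⟨c, R₀, hc, hRc, hred, hd⟩ := exists_eq_C_mul_map v hR
  refine ⟨c, R₀, hRc, ?_⟩
  have h1 : aeval (IsLocalRing.residue v.valuationSubring x)
      (R₀.map (IsLocalRing.residue (restr K v).valuationSubring)) ≠ 0 := by
    intro h0
    have h3 := hn.trans (natDegree_le_of_dvd (minpoly.dvd _ _ h0) hred)
    have h2 := natDegree_map_le (p := R₀)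
      (f := IsLocalRing.residue (restr K v).valuationSubring)
    omega
  rw [← residue_eval_map, ne_eq, residue_eq_zero_iff, coe_eval_map] at h1
  have h2 : v (aeval (x : L) (R₀.map (algebraMap (restr K v).valuationSubring K))) ≤ 1 := by
    rw [← coe_eval_map]
    exact (eval x (R₀.map (algebraMap _ v.valuationSubring))).2
  rw [hRc, map_mul, aeval_C, map_mul, le_antisymm h2 (not_lt.1 h1), mul_one]

/-- A form of the statement that the powers of `x` below the `n`-th are a valuation basis. -/
lemma map_coeff_le_map_aeval {n : ℕ} (x : v.valuationSubring)
    (hn : n ≤ (minpoly (residue (restr K v)) (IsLocalRing.residue v.valuationSubring x)).natDegree)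
    {R : K[X]} (hdeg : R.natDegree < n) (i : ℕ) :
    v (algebraMap K L (R.coeff i)) * v (x : L) ^ i ≤ v (aeval (x : L) R) := by
  by_cases hR : R = 0
  · simp [hR]
  obtain ⟨c, R₀, hRc, hv⟩ := exists_map_aeval_eq v x hn hR hdeg
  rw [hv]
  have h1 : v (x : L) ≤ 1 := x.2
  have h2 : v (algebraMap K L (R.coeff i)) ≤ v (algebraMap K L c) := by
    rw [hRc, coeff_C_mul, coeff_map, map_mul, map_mul]
    exact mul_le_of_le_one_right' (R₀.coeff i).2
  exact (mul_le_of_le_one_right' (pow_le_one' h1 i)).trans h2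

end Residues

/-! ### Best approximations by elements of the base field -/

section Distances

variable {K L Γ : Type*} [Field K] [Field L] [Algebra K L] [LinearOrderedCommGroupWithZero Γ]
  (v : Valuation L Γ) {p : ℕ}

/-- If the powers of `x` are a valuation basis, then the distances to `K` have a least element. -/
lemma exists_isLeast_valueSet {x θ : L} (hθ : ∀ c : K, θ ≠ algebraMap K L c)
    (hx : ∀ R : K[X], R.natDegree < p →
      ∀ i, v (algebraMap K L (R.coeff i)) * v x ^ i ≤ v (aeval x R))
    (hgen : ∃ R : K[X], R.natDegree < p ∧ θ = aeval x R) :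
    ∃ γ : Γˣ, IsLeast (valueSet K v θ) γ := by
  obtain ⟨R, hR, rfl⟩ := hgen
  have hne : ∀ c : K, v (aeval x R - algebraMap K L c) ≠ 0 := fun c => by
    rw [Valuation.ne_zero_iff, sub_ne_zero]; exact hθ c
  -- The constant term is a best approximation: subtracting another constant leaves the terms of
  -- positive degree unchanged, and each of them is bounded by the value of the whole.
  refine ⟨Units.mk0 _ (hne (R.coeff 0)), ⟨R.coeff 0, rfl⟩, ?_⟩
  rintro γ ⟨c, hc⟩
  rw [← Units.val_le_val, ← hc, Units.val_mk0]
  have hsub : ∀ d : K, aeval x R - algebraMap K L d = aeval x (R - C d) := by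
    intro d; simp
  have hdeg : ∀ d : K, (R - C d).natDegree < p := fun d => by rwa [natDegree_sub_C]
  rw [hsub (R.coeff 0), aeval_eq_sum_range]
  refine v.map_sum_le fun i _ => ?_
  rw [Algebra.smul_def, map_mul, map_pow]
  by_cases hi : i = 0
  · simp [hi]
  · rw [hsub c]
    have := hx _ (hdeg c) i
    simpa [coeff_C, hi] using this

end Distances

/-! ### Generators of extensions of prime degree -/

section PrimeDegree

variable {K L : Type*} [Field K] [Field L] [Algebra K L] {p : ℕ}

lemma adjoin_eq_top_of_prime_degree (hp : p.Prime) (hdeg : Module.finrank K L = p) {x : L}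
    (hx : ∀ c : K, x ≠ algebraMap K L c) : K⟮x⟯ = ⊤ := by
  have hbt := (IntermediateField.isSimpleOrder_of_finrank_prime K L
    (hdeg ▸ hp)).eq_bot_or_eq_top K⟮x⟯
  refine hbt.resolve_left fun h => ?_
  obtain ⟨c, hc⟩ := IntermediateField.mem_bot.1 (IntermediateField.adjoin_simple_eq_bot_iff.1 h)
  exact hx c hc.symm

variable [FiniteDimensional K L]

lemma natDegree_minpoly_of_prime_degree (hp : p.Prime) (hdeg : Module.finrank K L = p) {x : L}
    (hx : ∀ c : K, x ≠ algebraMap K L c) : (minpoly K x).natDegree = p := by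
  rw [← IntermediateField.adjoin.finrank (IsIntegral.of_finite K x),
    adjoin_eq_top_of_prime_degree hp hdeg hx, ← hdeg, IntermediateField.finrank_top']

lemma aeval_ne_zero_of_prime_degree (hp : p.Prime) (hdeg : Module.finrank K L = p) {x : L}
    (hx : ∀ c : K, x ≠ algebraMap K L c) {R : K[X]} (hR : R.natDegree < p) (hR0 : R ≠ 0) :
    aeval x R ≠ 0 := fun h =>
  (natDegree_le_of_dvd (minpoly.dvd K x h) hR0).not_gt
    (by rwa [natDegree_minpoly_of_prime_degree hp hdeg hx])

lemma exists_eq_aeval_of_prime_degree (hp : p.Prime) (hdeg : Module.finrank K L = p) {x : L}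
    (hx : ∀ c : K, x ≠ algebraMap K L c) (y : L) :
    ∃ R : K[X], R.natDegree < p ∧ y = aeval x R := by
  have hint : IsIntegral K x := IsIntegral.of_finite K x
  have hy : y ∈ K⟮x⟯.toSubalgebra := by
    rw [adjoin_eq_top_of_prime_degree hp hdeg hx]; trivial
  rw [IntermediateField.adjoin_simple_toSubalgebra_of_isAlgebraic hint.isAlgebraic,
    Algebra.adjoin_singleton_eq_range_aeval] at hy
  obtain ⟨P, hP⟩ := hy
  refine ⟨P %ₘ minpoly K x, ?_, ?_⟩
  · rw [← natDegree_minpoly_of_prime_degree hp hdeg hx]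
    exact natDegree_modByMonic_lt _ (minpoly.monic hint) (minpoly.ne_one K x)
  · rw [← hP]
    exact (Polynomial.modByMonic_eq_sub_mul_div P (minpoly K x) ▸ by simp)

end PrimeDegree

/-! ### Galois action on residues and the value group -/

section Galois

variable {K L Γ : Type*} [Field K] [Field L] [Algebra K L] [LinearOrderedCommGroupWithZero Γ]
  (v : Valuation L Γ)

/-- The elements of the Galois group that move `x` only by a small amount. -/
def residueStabilizer (hv : ∀ (σ : L ≃ₐ[K] L) (y : L), v (σ y) = v y) (x : L) :
    Subgroup (L ≃ₐ[K] L) where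
  carrier := {σ | v (σ x - x) < 1}
  one_mem' := by simp
  mul_mem' := by
    intro σ τ hσ hτ
    have h : (σ * τ) x - x = σ (τ x - x) + (σ x - x) := by
      rw [map_sub]; simp
    change v ((σ * τ) x - x) < 1
    rw [h]
    exact v.map_add_lt (by rw [hv]; exact hτ) hσ
  inv_mem' := by
    intro σ hσ
    change v (σ⁻¹ x - x) < 1
    have h : σ (σ⁻¹ x - x) = -(σ x - x) := by
      rw [map_sub, ← AlgEquiv.mul_apply, mul_inv_cancel]; simp
    rw [← hv σ, h, Valuation.map_neg]
    exact hσ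

lemma mem_residueStabilizer (hv : ∀ (σ : L ≃ₐ[K] L) (y : L), v (σ y) = v y) {x : L}
    {σ : L ≃ₐ[K] L} : σ ∈ residueStabilizer v hv x ↔ v (σ x - x) < 1 := Iff.rfl

variable [FiniteDimensional K L] [IsGalois K L] {p : ℕ}

/-- The residue of `x` is a root of the reduction of the characteristic polynomial of `x`. -/
lemma exists_monic_residue_map_eq_prod (hv : ∀ (σ : L ≃ₐ[K] L) (y : L), v (σ y) = v y)
    (hdeg : Module.finrank K L = p) (x : v.valuationSubring) :
    ∃ q : (residue (restr K v))[X], q.Monic ∧ q.natDegree = p ∧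
      q.map (algebraMap (residue (restr K v)) (residue v)) =
        ∏ σ : L ≃ₐ[K] L, (X - C (IsLocalRing.residue v.valuationSubring
          ⟨σ x, (hv σ x).le.trans x.2⟩)) := by
  obtain ⟨Q, hQm, hQ⟩ := exists_monic_map_eq_prod_conjugates v
    (x := (x : L)) (fun σ : L ≃ₐ[K] L => (hv σ x).le.trans x.2)
  have hmap : (Q.map (IsLocalRing.residue (restr K v).valuationSubring)).map
      (algebraMap (residue (restr K v)) (residue v)) =
        ∏ σ : L ≃ₐ[K] L, (X - C (IsLocalRing.residue v.valuationSubring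
          ⟨σ x, (hv σ x).le.trans x.2⟩)) := by
    have h := congrArg (Polynomial.map (IsLocalRing.residue v.valuationSubring)) hQ
    rw [Polynomial.map_map, Polynomial.map_prod] at h
    simp only [Polynomial.map_sub, Polynomial.map_X, Polynomial.map_C] at h
    rw [Polynomial.map_map]
    exact h
  refine ⟨_, hQm.map _, ?_, hmap⟩
  rw [← natDegree_map_eq_of_injective
    (algebraMap (residue (restr K v)) (residue v)).injective, hmap,
    natDegree_prod_of_monic _ _ (fun σ _ => monic_X_sub_C _)]
  simp only [natDegree_X_sub_C, Finset.sum_const, smul_eq_mul, mul_one, Finset.card_univ]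
  rw [← Nat.card_eq_fintype_card, IsGalois.card_aut_eq_finrank, hdeg]

/-- When the group fixes the residue ξ, the reduced characteristic polynomial is (X - ξ) ^ p, and
its constant term is ξ ^ p up to sign. -/
lemma pow_residue_mem_range (hv : ∀ (σ : L ≃ₐ[K] L) (y : L), v (σ y) = v y)
    (hp : p.Prime) (hdeg : Module.finrank K L = p) [CharP (residue (restr K v)) p]
    (x : v.valuationSubring) (hfix : ∀ σ : L ≃ₐ[K] L, v (σ x - x) < 1) :
    ∃ b : residue (restr K v),
      IsLocalRing.residue v.valuationSubring x ^ p = algebraMap _ (residue v) b := by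
  obtain ⟨q, -, hqd, hq⟩ := exists_monic_residue_map_eq_prod v hv hdeg x
  have : CharP (residue v) p :=
    charP_of_injective_algebraMap (algebraMap (residue (restr K v)) (residue v)).injective p
  have : Fact p.Prime := ⟨hp⟩
  have hcard : Fintype.card (L ≃ₐ[K] L) = p := by
    rw [← hdeg, ← Nat.card_eq_fintype_card, IsGalois.card_aut_eq_finrank]
  have hres : ∀ σ : L ≃ₐ[K] L, IsLocalRing.residue v.valuationSubring
      ⟨σ x, (hv σ x).le.trans x.2⟩ = IsLocalRing.residue v.valuationSubring x := fun σ =>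
    (residue_eq_iff v _ _).2 (hfix σ)
  simp only [hres, Finset.prod_const, Finset.card_univ, hcard] at hq
  have h0 := congrArg (Polynomial.eval 0) hq
  rw [← coeff_zero_eq_eval_zero, coeff_map] at h0
  simp only [eval_pow, eval_sub, eval_X, eval_C, zero_sub] at h0
  refine ⟨(-1) ^ p * q.coeff 0, ?_⟩
  rw [map_mul, h0, map_pow, map_neg, map_one, ← mul_pow]
  congr 1; ring

/-- In a Galois extension of prime degree, an element of the residue field not in the residue
field of `K` has degree `p`. -/
lemma natDegree_minpoly_residue (hv : ∀ (σ : L ≃ₐ[K] L) (y : L), v (σ y) = v y)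
    (hp : p.Prime) (hdeg : Module.finrank K L = p) [CharP (residue (restr K v)) p]
    (x : v.valuationSubring)
    (hx : ∀ c, IsLocalRing.residue v.valuationSubring x ≠
      algebraMap (residue (restr K v)) (residue v) c) :
    IsIntegral (residue (restr K v)) (IsLocalRing.residue v.valuationSubring x) ∧
    (minpoly (residue (restr K v)) (IsLocalRing.residue v.valuationSubring x)).natDegree = p := by
  classical
  obtain ⟨q, hqm, hqd, hq⟩ := exists_monic_residue_map_eq_prod v hv hdeg x
  have : CharP (residue v) p :=
    charP_of_injective_algebraMap (algebraMap (residue (restr K v)) (residue v)).injective p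
  have : Fact p.Prime := ⟨hp⟩
  have hcard : Fintype.card (L ≃ₐ[K] L) = p := by
    rw [← hdeg, ← Nat.card_eq_fintype_card, IsGalois.card_aut_eq_finrank]
  have hroot : aeval (IsLocalRing.residue v.valuationSubring x) q = 0 := by
    rw [← eval_map_algebraMap, hq, eval_prod]
    exact Finset.prod_eq_zero (Finset.mem_univ 1) (by simp)
  have hint : IsIntegral (residue (restr K v)) (IsLocalRing.residue v.valuationSubring x) :=
    ⟨q, hqm, by simpa [aeval_def] using hroot⟩
  refine ⟨hint, ?_⟩
  have : Fact (Nat.card (L ≃ₐ[K] L)).Prime := ⟨by rw [Nat.card_eq_fintype_card, hcard]; exact hp⟩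
  -- With trivial stabilizer the conjugates have `p` distinct residues, all roots of the minimal
  -- polynomial. With full stabilizer the residue is a `p`-th root of some `b` in Kν, and X ^ p - b
  -- is irreducible by injectivity of Frobenius.
  rcases Subgroup.eq_bot_or_eq_top_of_prime_card (residueStabilizer v hv (x : L)) with h | h
  · refine le_antisymm (hqd ▸ natDegree_le_of_dvd (minpoly.dvd _ _ hroot) hqm.ne_zero) ?_
    -- An integral lift of the minimal polynomial has small value at `x`, hence also at every
    -- conjugate of `x`.
    obtain ⟨R, hR⟩ := Polynomial.map_surjective (IsLocalRing.residue (restr K v).valuationSubring)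
      IsLocalRing.residue_surjective
      (minpoly (residue (restr K v)) (IsLocalRing.residue v.valuationSubring x))
    have hRx : v (aeval (x : L) (R.map (algebraMap (restr K v).valuationSubring K))) < 1 := by
      rw [← coe_eval_map, ← residue_eq_zero_iff, residue_eval_map, hR, minpoly.aeval]
    let f : (L ≃ₐ[K] L) → residue v := fun σ =>
      IsLocalRing.residue v.valuationSubring ⟨σ x, (hv σ x).le.trans x.2⟩
    have hf : Function.Injective f := by
      intro σ τ hστ
      have h1 := (residue_eq_iff v _ _).1 hστ
      have h2 : τ⁻¹ * σ ∈ residueStabilizer v hv (x : L) := by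
        rw [mem_residueStabilizer, ← hv τ, map_sub, ← AlgEquiv.mul_apply, mul_inv_cancel_left]
        exact h1
      rw [h, Subgroup.mem_bot, inv_mul_eq_one] at h2
      exact h2.symm
    have hne : minpoly (residue (restr K v)) (IsLocalRing.residue v.valuationSubring x) ≠ 0 :=
      minpoly.ne_zero hint
    have hfr : ∀ σ, f σ ∈ (minpoly (residue (restr K v))
        (IsLocalRing.residue v.valuationSubring x)).rootSet (residue v) := by
      intro σ
      rw [mem_rootSet]
      refine ⟨hne, ?_⟩
      have h3 := residue_eval_map v ⟨σ x, (hv σ x).le.trans x.2⟩ R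
      rw [hR] at h3
      change aeval (IsLocalRing.residue v.valuationSubring ⟨σ x, _⟩) _ = 0
      rw [← h3, residue_eq_zero_iff, coe_eval_map]
      change v (aeval (σ (x : L)) _) < 1
      rw [aeval_algHom_apply σ (x : L)]
      exact (hv σ _).trans_lt hRx
    calc p = (Finset.univ.image f).card := by
          rw [Finset.card_image_of_injective _ hf, Finset.card_univ, hcard]
      _ ≤ (((minpoly (residue (restr K v))
        (IsLocalRing.residue v.valuationSubring x)).map
          (algebraMap (residue (restr K v)) (residue v))).roots.toFinset).card := by
          refine Finset.card_le_card fun y hy => ?_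
          obtain ⟨σ, -, rfl⟩ := Finset.mem_image.1 hy
          simpa [mem_rootSet', aeval_def, eval_map] using hfr σ
      _ ≤ _ := Multiset.toFinset_card_le _
      _ ≤ _ := card_roots' _
      _ ≤ _ := natDegree_map_le
  · obtain ⟨b, hb⟩ := pow_residue_mem_range v hv hp hdeg x (fun σ => by
      have : σ ∈ residueStabilizer v hv (x : L) := h ▸ Subgroup.mem_top σ
      exact this)
    have hirr : Irreducible (X ^ p - C b : (residue (restr K v))[X]) := by
      refine X_pow_sub_C_irreducible_of_prime hp fun c hc => hx c ?_
      rw [← hc, map_pow] at hb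
      exact frobenius_inj (residue v) p hb
    rw [← minpoly.eq_of_irreducible_of_monic hirr (by simp [hb]) (monic_X_pow_sub_C b hp.ne_zero),
      natDegree_X_pow_sub_C]

/-- The value group of a Galois extension of degree `p` modulo that of `K` has exponent `p`. -/
lemma pow_mem_vGroup_restr (hv : ∀ (σ : L ≃ₐ[K] L) (y : L), v (σ y) = v y)
    (hdeg : Module.finrank K L = p) {γ : Γˣ} (hγ : γ ∈ vGroup v) :
    γ ^ p ∈ vGroup (restr K v) := by
  obtain ⟨y, hy⟩ := (mem_vGroup_iff v).1 hγ
  refine (mem_vGroup_restr_iff K v).2 ⟨Algebra.norm K y, ?_⟩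
  rw [Algebra.norm_eq_prod_automorphisms, map_prod]
  simp only [hv, Finset.prod_const, Finset.card_univ]
  rw [← Nat.card_eq_fintype_card, IsGalois.card_aut_eq_finrank, hdeg, hy, Units.val_pow_eq_pow_val]

lemma isPGroup_vGroup_quotient (hv : ∀ (σ : L ≃ₐ[K] L) (y : L), v (σ y) = v y)
    (hdeg : Module.finrank K L = p) :
    IsPGroup p (vGroup v ⧸ (vGroup (restr K v)).subgroupOf (vGroup v)) := by
  intro g
  obtain ⟨γ, rfl⟩ := QuotientGroup.mk_surjective g
  refine ⟨1, ?_⟩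
  rw [pow_one, ← QuotientGroup.mk_pow, QuotientGroup.eq_one_iff, Subgroup.mem_subgroupOf]
  exact pow_mem_vGroup_restr v hv hdeg γ.2

end Galois

/-! ### Extensions with a new residue -/

section ResidueExtension

variable {K L Γ : Type*} [Field K] [Field L] [Algebra K L] [LinearOrderedCommGroupWithZero Γ]
  (v : Valuation L Γ)

lemma ne_algebraMap_of_residue_ne {x : v.valuationSubring}
    (hx : ∀ c, IsLocalRing.residue v.valuationSubring x ≠
      algebraMap (residue (restr K v)) (residue v) c) (c : K) : (x : L) ≠ algebraMap K L c := by
  intro h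
  have hc : v (algebraMap K L c) ≤ 1 := h ▸ x.2
  refine hx (IsLocalRing.residue (restr K v).valuationSubring ⟨c, hc⟩) ?_
  rw [Valuation.HasExtension.algebraMap_residue_eq_residue_algebraMap]
  exact congrArg _ (Subtype.ext h)

variable [FiniteDimensional K L] [IsGalois K L] {p : ℕ}
  (hv : ∀ (σ : L ≃ₐ[K] L) (y : L), v (σ y) = v y)
  (hp : p.Prime) (hdeg : Module.finrank K L = p) [CharP (residue (restr K v)) p]
  {x : v.valuationSubring}
  (hx : ∀ c, IsLocalRing.residue v.valuationSubring x ≠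
    algebraMap (residue (restr K v)) (residue v) c)

include hv hp hdeg hx

/-- Every element is a polynomial in `x` of degree below `p`, so its value is that of a constant. -/
lemma vGroup_eq_of_residue_ne : vGroup v = vGroup (restr K v) := by
  refine le_antisymm (fun γ hγ => ?_) (vGroup_restr_le K v)
  obtain ⟨y, hy⟩ := (mem_vGroup_iff v).1 hγ
  obtain ⟨R, hR, rfl⟩ := exists_eq_aeval_of_prime_degree hp hdeg
    (ne_algebraMap_of_residue_ne v hx) y
  have hR0 : R ≠ 0 := by
    rintro rfl
    simp only [map_zero] at hy
    exact γ.ne_zero hy.symm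
  obtain ⟨c, R₀, -, hc⟩ := exists_map_aeval_eq v x
    (natDegree_minpoly_residue v hv hp hdeg x hx).2.ge hR0 hR
  exact (mem_vGroup_restr_iff K v).2 ⟨c, by rw [← hc, hy]⟩

/-- A unit written as a polynomial in `x` of degree below `p` has integral coefficients, so its
residue is a polynomial in the residue of `x`. -/
lemma adjoin_residue_eq_top :
    (residue (restr K v))⟮IsLocalRing.residue v.valuationSubring x⟯ = ⊤ := by
  rw [eq_top_iff]
  rintro ω -
  obtain ⟨y, rfl⟩ := IsLocalRing.residue_surjective ω
  by_cases hy : IsLocalRing.residue v.valuationSubring y = 0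
  · rw [hy]; exact zero_mem _
  have hy1 : v (y : L) = 1 := le_antisymm y.2 (not_lt.1 fun h => hy ((residue_eq_zero_iff v y).2 h))
  obtain ⟨R, hR, hyR⟩ := exists_eq_aeval_of_prime_degree hp hdeg
    (ne_algebraMap_of_residue_ne v hx) (y : L)
  have hR0 : R ≠ 0 := by
    rintro rfl
    rw [hyR, map_zero, map_zero] at hy1
    exact zero_ne_one hy1
  obtain ⟨c, R₀, hRc, hc⟩ := exists_map_aeval_eq v x
    (natDegree_minpoly_residue v hv hp hdeg x hx).2.ge hR0 hR
  rw [← hyR, hy1] at hc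
  have hyc : y = (((C ⟨c, hc.ge⟩ : (restr K v).valuationSubring[X]) * R₀).map
      (algebraMap (restr K v).valuationSubring v.valuationSubring)).eval x := by
    apply Subtype.ext
    rw [coe_eval_map, hyR, hRc, Polynomial.map_mul, map_C]
    rfl
  rw [hyc, residue_eval_map]
  exact IntermediateField.algebra_adjoin_le_adjoin _ _ (aeval_mem_adjoin_singleton _ _)

lemma inertiaDeg_eq_of_residue_ne : inertiaDeg K v = p := by
  obtain ⟨hint, hmin⟩ := natDegree_minpoly_residue v hv hp hdeg x hx
  rw [inertiaDeg, ← hmin, ← IntermediateField.adjoin.finrank hint,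
    adjoin_residue_eq_top v hv hp hdeg hx, IntermediateField.finrank_top']

lemma isDefectless_of_residue_ne : IsDefectless K v := by
  refine ⟨inferInstance, ?_⟩
  rw [inertiaDeg_eq_of_residue_ne v hv hp hdeg hx, ramIdx,
    vGroup_eq_of_residue_ne v hv hp hdeg hx, Subgroup.relIndex_self, one_mul, hdeg]

lemma isPurelyWild_of_residue_ne (hfix : ∀ σ : L ≃ₐ[K] L, v (σ x - x) < 1) :
    IsPurelyWild K v p := by
  refine ⟨inferInstance, isPGroup_vGroup_quotient v hv hdeg, ?_⟩
  have : Fact p.Prime := ⟨hp⟩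
  obtain ⟨b, hb⟩ := pow_residue_mem_range v hv hp hdeg x hfix
  have h : IsPurelyInseparable (residue (restr K v))
      (residue (restr K v))⟮IsLocalRing.residue v.valuationSubring x⟯ := by
    rw [IntermediateField.isPurelyInseparable_adjoin_simple_iff_pow_mem _ _ p]
    exact ⟨1, b, by rw [pow_one, hb]⟩
  rw [adjoin_residue_eq_top v hv hp hdeg hx] at h
  exact (IntermediateField.topEquiv (F := residue (restr K v))
    (E := residue v)).isPurelyInseparable

lemma isSeparable_residue (hsep : IsSeparable (residue (restr K v))
    (IsLocalRing.residue v.valuationSubring x)) :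
    Algebra.IsSeparable (residue (restr K v)) (residue v) := by
  have h := (IntermediateField.isSeparable_adjoin_simple_iff_isSeparable
    (residue (restr K v)) (residue v)).2 hsep
  rw [adjoin_residue_eq_top v hv hp hdeg hx] at h
  exact AlgEquiv.Algebra.isSeparable
    (IntermediateField.topEquiv (F := residue (restr K v)) (E := residue v))

end ResidueExtension

/-! ### Unramified extensions -/

section Unramified

variable {K L Γ : Type*} [Field K] [Field L] [Algebra K L] [LinearOrderedCommGroupWithZero Γ]
  (v : Valuation L Γ) {p : ℕ}

lemma isSeparable_residue_intermediateField (E : IntermediateField K L)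
    [Algebra.IsSeparable (residue (restr K v)) (residue v)] :
    Algebra.IsSeparable (residue (restr K (restr E v))) (residue (restr E v)) := by
  -- Restricting `v` to `K` directly or through `E` gives definitionally the same valuation, so the
  -- residue fields form a tower.
  let _ : Algebra (residue (restr K (restr E v))) (residue v) :=
    inferInstanceAs (Algebra (residue (restr K v)) (residue v))
  have : Algebra.IsSeparable (residue (restr K (restr E v))) (residue v) := ‹_›
  have : IsScalarTower (residue (restr K (restr E v))) (residue (restr E v)) (residue v) := by
    refine IsScalarTower.of_algebraMap_eq fun z => ?_
    obtain ⟨z, rfl⟩ := IsLocalRing.residue_surjective z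
    rfl
  exact Algebra.isSeparable_tower_bot_of_isSeparable _ _ (residue v)

/-- An algebraic extension without ramification and with separable residue field extension is
unramified. -/
lemma isUnramified_of_isSeparable (hp : p.Prime) [Algebra.IsAlgebraic K L]
    (hΓ : vGroup v = vGroup (restr K v))
    [Algebra.IsSeparable (residue (restr K v)) (residue v)] : IsUnramified K v p := by
  refine ⟨⟨inferInstance, fun E _ => ⟨?_, isSeparable_residue_intermediateField v E⟩⟩, hΓ⟩
  have h1 : vGroup (restr E v) = vGroup (restr K (restr E v)) := by
    refine le_antisymm ?_ (vGroup_restr_le K (restr E v))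
    exact (vGroup_restr_le E v).trans hΓ.le
  rw [ramIdx, h1, Subgroup.relIndex_self]
  exact hp.not_dvd_one

end Unramified

/-! ### Extensions with a new value -/

section Ramified

variable {K L Γ : Type*} [Field K] [Field L] [Algebra K L] [LinearOrderedCommGroupWithZero Γ]
  (v : Valuation L Γ) {p : ℕ} {x : L} {g : Γˣ} (hg : v x = g)
  (hp : p.Prime) (hgp : g ^ p ∈ vGroup (restr K v)) (hgK : g ∉ vGroup (restr K v))

include hp hgp hgK in
lemma zpow_mem_vGroup_restr_iff (n : ℤ) : g ^ n ∈ vGroup (restr K v) ↔ (p : ℤ) ∣ n := by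
  have : Fact p.Prime := ⟨hp⟩
  have hord : orderOf (g : Γˣ ⧸ vGroup (restr K v)) = p := by
    refine orderOf_eq_prime ?_ ?_
    · rw [← QuotientGroup.mk_pow, QuotientGroup.eq_one_iff]; exact hgp
    · rw [ne_eq, QuotientGroup.eq_one_iff]; exact hgK
  rw [← QuotientGroup.eq_one_iff, QuotientGroup.mk_zpow, ← hord, orderOf_dvd_iff_zpow_eq_one]

include hg hp hgp hgK in
/-- The powers of `x` below the `p`-th have values in distinct cosets of the value group of `K`,
so the value of a polynomial at `x` is that of a single term. -/
lemma exists_map_aeval_eq_term {R : K[X]} (hR : R.natDegree < p) (hR0 : aeval x R ≠ 0) :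
    ∃ j < p, v (aeval x R) = v (algebraMap K L (R.coeff j)) * v x ^ j ∧
      ∀ i < p, i ≠ j → v (algebraMap K L (R.coeff i)) * v x ^ i < v (aeval x R) := by
  classical
  obtain ⟨j, hj, hmax⟩ := Finset.exists_max_image (Finset.range p)
    (fun i => v (R.coeff i • x ^ i)) ⟨0, Finset.mem_range.2 hp.pos⟩
  have hsum : aeval x R = ∑ i ∈ Finset.range p, R.coeff i • x ^ i := aeval_eq_sum_range' hR x
  have hterm : ∀ i, v (R.coeff i • x ^ i) = v (algebraMap K L (R.coeff i)) * v x ^ i := fun i => by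
    rw [Algebra.smul_def, map_mul, map_pow]
  have hj0 : v (R.coeff j • x ^ j) ≠ 0 := by
    intro h0
    apply hR0
    rw [hsum]
    refine Finset.sum_eq_zero fun i hi => ?_
    rw [← v.zero_iff, ← le_zero_iff, ← h0]
    exact hmax i hi
  have hlt : ∀ i ∈ Finset.range p, i ≠ j → v (R.coeff i • x ^ i) < v (R.coeff j • x ^ j) := by
    intro i hi hij
    refine lt_of_le_of_ne (hmax i hi) fun heq => hij ?_
    have hi0 := heq ▸ hj0
    rw [hterm, hterm, hg] at heq
    rw [hterm] at hi0 hj0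
    have hci := left_ne_zero_of_mul hi0
    have hcj := left_ne_zero_of_mul hj0
    -- Two terms of equal value would put a power of `g` with nonzero exponent of absolute value
    -- below `p` into the value group of `K`.
    have hmem : g ^ ((i : ℤ) - j) ∈ vGroup (restr K v) := by
      refine (mem_vGroup_restr_iff K v).2 ⟨R.coeff j / R.coeff i, ?_⟩
      rw [map_div₀, map_div₀, div_eq_iff hci, zpow_sub, Units.val_mul, zpow_natCast, zpow_natCast,
        mul_comm, ← mul_assoc, Units.val_pow_eq_pow_val, heq, mul_assoc,
        ← Units.val_pow_eq_pow_val, Units.mul_inv, mul_one]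
    rw [zpow_mem_vGroup_restr_iff v hp hgp hgK] at hmem
    have hi' := Finset.mem_range.1 hi
    have hj' := Finset.mem_range.1 hj
    have := Int.eq_zero_of_abs_lt_dvd hmem (by rw [abs_lt]; omega)
    omega
  have hval : v (aeval x R) = v (R.coeff j • x ^ j) := by
    rw [hsum]
    refine v.map_sum_eq_of_lt hj fun i hi => ?_
    rw [Finset.mem_sdiff, Finset.mem_singleton] at hi
    exact hlt i hi.1 hi.2
  refine ⟨j, Finset.mem_range.1 hj, by rw [hval, hterm], fun i hi hij => ?_⟩
  rw [hval, ← hterm]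
  exact hlt i (Finset.mem_range.2 hi) hij

lemma ne_algebraMap_of_ramified (hg : v x = g) (hgK : g ∉ vGroup (restr K v)) (c : K) :
    x ≠ algebraMap K L c := by
  rintro rfl
  exact hgK ((mem_vGroup_restr_iff K v).2 ⟨c, hg⟩)

variable [FiniteDimensional K L] (hdeg : Module.finrank K L = p)

include hg hp hgp hgK hdeg

lemma map_coeff_le_map_aeval_of_ramified {R : K[X]} (hR : R.natDegree < p) (i : ℕ) :
    v (algebraMap K L (R.coeff i)) * v x ^ i ≤ v (aeval x R) := by
  by_cases h0 : R = 0
  · simp [h0]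
  obtain ⟨j, hj, hvj, hlt⟩ := exists_map_aeval_eq_term v hg hp hgp hgK hR
    (aeval_ne_zero_of_prime_degree hp hdeg (ne_algebraMap_of_ramified v hg hgK) hR h0)
  by_cases hi : i < p
  · by_cases hij : i = j
    · rw [hij, hvj]
    · exact (hlt i hi hij).le
  · rw [coeff_eq_zero_of_natDegree_lt (by omega), map_zero, map_zero, zero_mul]
    exact zero_le

lemma ramIdx_eq_of_ramified : ramIdx K v = p := by
  have : Fact p.Prime := ⟨hp⟩
  let g' : vGroup v := ⟨g, (mem_vGroup_iff v).2 ⟨x, hg⟩⟩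
  let H := (vGroup (restr K v)).subgroupOf (vGroup v)
  have hord : orderOf (g' : vGroup v ⧸ H) = p := by
    refine orderOf_eq_prime ?_ ?_
    · rw [← QuotientGroup.mk_pow, QuotientGroup.eq_one_iff]; exact hgp
    · rw [ne_eq, QuotientGroup.eq_one_iff]; exact hgK
  have htop : Subgroup.zpowers (g' : vGroup v ⧸ H) = ⊤ := by
    rw [eq_top_iff]
    rintro q -
    obtain ⟨⟨γ, hγ⟩, rfl⟩ := QuotientGroup.mk_surjective q
    obtain ⟨y, hy⟩ := (mem_vGroup_iff v).1 hγ
    obtain ⟨R, hR, rfl⟩ := exists_eq_aeval_of_prime_degree hp hdeg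
      (ne_algebraMap_of_ramified v hg hgK) y
    obtain ⟨j, -, hvj, -⟩ := exists_map_aeval_eq_term v hg hp hgp hgK hR
      (fun h => by rw [h, map_zero] at hy; exact γ.ne_zero hy.symm)
    refine ⟨j, ?_⟩
    simp only [zpow_natCast]
    rw [← QuotientGroup.mk_pow, QuotientGroup.eq, Subgroup.mem_subgroupOf]
    refine (mem_vGroup_restr_iff K v).2 ⟨R.coeff j, ?_⟩
    simp only [Subgroup.coe_mul, Subgroup.coe_inv, SubmonoidClass.coe_pow, g']
    rw [Units.val_mul, ← hy, hvj, hg, ← Units.val_pow_eq_pow_val, mul_left_comm, Units.inv_mul,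
      mul_one]
  rw [ramIdx, Subgroup.relIndex, Subgroup.index, ← hord, ← Nat.card_zpowers, htop,
    Subgroup.card_top]

/-- In the expansion of a unit in powers of `x`, the dominant term has value 1, which excludes
positive exponents. So the unit has the residue of its constant term. -/
lemma surjective_residue_of_ramified :
    Function.Surjective (algebraMap (residue (restr K v)) (residue v)) := by
  intro ω
  obtain ⟨y, rfl⟩ := IsLocalRing.residue_surjective ω
  by_cases hy : IsLocalRing.residue v.valuationSubring y = 0
  · exact ⟨0, by rw [hy, map_zero]⟩
  have hy1 : v (y : L) = 1 := le_antisymm y.2 (not_lt.1 fun h => hy ((residue_eq_zero_iff v y).2 h))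
  obtain ⟨R, hR, hyR⟩ := exists_eq_aeval_of_prime_degree hp hdeg
    (ne_algebraMap_of_ramified v hg hgK) (y : L)
  obtain ⟨j, hj, hvj, hlt⟩ := exists_map_aeval_eq_term v hg hp hgp hgK hR
    (fun h => by rw [hyR, h, map_zero] at hy1; exact zero_ne_one hy1)
  rw [← hyR, hy1] at hvj hlt
  have hj0 : j = 0 := by
    by_contra hne
    have hc : v (algebraMap K L (R.coeff j)) ≠ 0 := fun h => by
      rw [h, zero_mul] at hvj
      exact one_ne_zero hvj
    have hmem : g ^ (j : ℤ) ∈ vGroup (restr K v) := by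
      refine (mem_vGroup_restr_iff K v).2 ⟨(R.coeff j)⁻¹, ?_⟩
      rw [map_inv₀, map_inv₀, zpow_natCast, Units.val_pow_eq_pow_val, ← hg]
      exact inv_eq_of_mul_eq_one_right hvj.symm
    rw [zpow_mem_vGroup_restr_iff v hp hgp hgK, Int.natCast_dvd_natCast] at hmem
    exact absurd (Nat.le_of_dvd (Nat.pos_of_ne_zero hne) hmem) (by omega)
  subst hj0
  rw [pow_zero, mul_one] at hvj
  refine ⟨IsLocalRing.residue (restr K v).valuationSubring ⟨R.coeff 0, hvj.ge⟩, ?_⟩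
  rw [Valuation.HasExtension.algebraMap_residue_eq_residue_algebraMap, eq_comm, residue_eq_iff]
  change v ((y : L) - algebraMap K L (R.coeff 0)) < 1
  rw [hyR, aeval_eq_sum_range' hR, ← Finset.add_sum_erase _ _ (Finset.mem_range.2 hp.pos),
    pow_zero, Algebra.smul_def, mul_one, add_sub_cancel_left]
  refine v.map_sum_lt one_ne_zero fun i hi => ?_
  rw [Finset.mem_erase, Finset.mem_range] at hi
  rw [Algebra.smul_def, map_mul, map_pow]
  exact hlt i hi.2 hi.1

lemma isPurelyWild_of_ramified [IsGalois K L] [CharP (residue (restr K v)) p]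
    (hv : ∀ (σ : L ≃ₐ[K] L) (y : L), v (σ y) = v y) : IsPurelyWild K v p := by
  refine ⟨inferInstance, isPGroup_vGroup_quotient v hv hdeg, ?_⟩
  have : Fact p.Prime := ⟨hp⟩
  rw [isPurelyInseparable_iff_pow_mem _ p]
  exact fun ω => ⟨0, by
    simpa using surjective_residue_of_ramified v hg hp hgp hgK hdeg ω⟩

lemma isDefectless_of_ramified : IsDefectless K v := by
  refine ⟨inferInstance, ?_⟩
  have hs := surjective_residue_of_ramified v hg hp hgp hgK hdeg
  have : inertiaDeg K v = 1 := by
    rw [inertiaDeg, ← (AlgEquiv.ofBijective (Algebra.ofId (residue (restr K v)) (residue v))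
      ⟨RingHom.injective _, hs⟩).toLinearEquiv.finrank_eq, Module.finrank_self]
  rw [ramIdx_eq_of_ramified v hg hp hgp hgK hdeg, this, mul_one, hdeg]

end Ramified

/-! ### The value of 1 - ζ -/

section RootsOfUnity

variable {L Γ : Type*} [Field L] [LinearOrderedCommGroupWithZero Γ] (v : Valuation L Γ) {p : ℕ}

lemma map_eq_one_of_isPrimitiveRoot (hp : p.Prime) {z : L} (hz : IsPrimitiveRoot z p) :
    v z = 1 := by
  have h := congrArg v hz.pow_eq_one
  rw [map_pow, map_one] at h
  exact (pow_left_inj₀ zero_le zero_le hp.ne_zero).1 (h.trans (one_pow p).symm)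

lemma map_one_sub_pow_le (hp : p.Prime) {z : L} (hz : IsPrimitiveRoot z p) (n : ℕ) :
    v (1 - z ^ n) ≤ v (1 - z) := by
  rw [← mul_neg_geom_sum z n, map_mul]
  refine mul_le_of_le_one_right' (v.map_sum_le fun i _ => ?_)
  rw [map_pow, map_eq_one_of_isPrimitiveRoot v hp hz, one_pow]

/-- The product of 1 - zᵏ over 0 < k < p equals `p`. All factors have the same value, because `z`
and zᵏ are powers of each other. -/
lemma map_one_sub_pow_sub_one (hp : p.Prime) {z : L} (hz : IsPrimitiveRoot z p) :
    v (1 - z) ^ (p - 1) = v (p : L) := by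
  obtain ⟨n, rfl⟩ : ∃ n, p = n + 1 := ⟨p - 1, by have := hp.pos; omega⟩
  rw [Nat.add_sub_cancel, Nat.cast_add, Nat.cast_one, ← hz.prod_one_sub_pow_eq_order, map_prod,
    Finset.prod_congr rfl (g := fun _ => v (1 - z)), Finset.prod_const, Finset.card_range]
  intro k hk
  refine le_antisymm (map_one_sub_pow_le v hp hz _) ?_
  have hcop : (k + 1).Coprime (n + 1) := by
    refine (Nat.coprime_of_lt_prime k.succ_ne_zero ?_ hp).symm
    have := Finset.mem_range.1 hk
    omega
  have hz' := hz.pow_of_coprime _ hcop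
  obtain ⟨m, -, hm⟩ := hz'.eq_pow_of_pow_eq_one hz.pow_eq_one
  have := map_one_sub_pow_le v hp hz' m
  rwa [hm] at this

end RootsOfUnity

/-! ### Kummer extensions of prime degree -/

section Kummer

variable {K L : Type*} [Field K] [Field L] [Algebra K L] {p : ℕ}

lemma IsKummerGenerator.isGalois (hp : p.Prime) {ζ : K} (hζ : IsPrimitiveRoot ζ p) {θ : L}
    (hθ : IsKummerGenerator p K θ) :
    FiniteDimensional K L ∧ IsGalois K L ∧ Module.finrank K L = p ∧
      ∃ σ : L ≃ₐ[K] L, σ θ = algebraMap K L ζ * θ := by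
  obtain ⟨⟨a, ha⟩, hne, htop⟩ := hθ
  have hNZ : NeZero p := ⟨hp.ne_zero⟩
  have hirr : Irreducible (X ^ p - C a) := by
    -- If `a` were a `p`-th power b ^ p in `K`, then θ/b would be a power of ζ and θ would lie in
    -- `K`.
    refine X_pow_sub_C_irreducible_of_prime hp fun b hb => ?_
    have hb0 : algebraMap K L b ≠ 0 := by
      rw [_root_.map_ne_zero]
      rintro rfl
      rw [← hb, zero_pow hp.ne_zero, map_zero] at ha
      exact hne 0 (by rw [map_zero]; exact eq_zero_of_pow_eq_zero ha)
    have h1 : (θ / algebraMap K L b) ^ p = 1 := by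
      rw [div_pow, ha, ← hb, map_pow, div_self (pow_ne_zero _ hb0)]
    obtain ⟨i, -, hi⟩ := (hζ.map_of_injective (algebraMap K L).injective).eq_pow_of_pow_eq_one h1
    refine hne (ζ ^ i * b) ?_
    rw [map_mul, map_pow, hi, div_mul_cancel₀ _ hb0]
  have hmin : X ^ p - C a = minpoly K θ :=
    minpoly.eq_of_irreducible_of_monic hirr (by simp [ha]) (monic_X_pow_sub_C a hp.ne_zero)
  have hint : IsIntegral K θ := ⟨X ^ p - C a, monic_X_pow_sub_C a hp.ne_zero, by simp [ha]⟩
  have hfin : FiniteDimensional K L := by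
    have h := IntermediateField.adjoin.finiteDimensional hint
    rw [htop] at h
    exact Module.Finite.equiv (IntermediateField.topEquiv (F := K) (E := L)).toLinearEquiv
  have hdeg : Module.finrank K L = p := by
    rw [← IntermediateField.finrank_top', ← htop, IntermediateField.adjoin.finrank hint, ← hmin,
      natDegree_X_pow_sub_C]
  have hprim : (primitiveRoots p K).Nonempty := ⟨ζ, (mem_primitiveRoots hp.pos).2 hζ⟩
  have hsplit : IsSplittingField K L (X ^ p - C a) := by
    have := isSplittingField_X_pow_sub_C_of_root_adjoin_eq_top (K := K) (L := L) (a := a) (α := θ)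
      (hdeg.symm ▸ hprim) (hdeg.symm ▸ ha) htop
    rwa [hdeg] at this
  refine ⟨hfin, isGalois_of_isSplittingField_X_pow_sub_C hprim hirr L, hdeg,
    (autEquivZmod hirr L hζ).symm (Multiplicative.ofAdd ((1 : ℕ) : ZMod p)), ?_⟩
  rw [autEquivZmod_symm_apply_natCast hirr L ha hζ 1, pow_one, Algebra.smul_def]

end Kummer

/-! ### Artin-Schreier residues -/

section ArtinSchreier

lemma isSeparable_of_pow_sub_self_eq {k l : Type*} {p : ℕ} [Field k] [Field l] [Algebra k l]
    [CharP k p] {ξ : l} {b : k} (hb : ξ ^ p - ξ = algebraMap k l b) : IsSeparable k ξ := by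
  have hA : (X ^ p - X - C b : k[X]).Separable := by
    refine ⟨0, -1, ?_⟩
    simp [derivative_X_pow, CharP.cast_eq_zero]
  exact hA.of_dvd (minpoly.dvd _ _ (by simp [hb]))

variable {K L Γ : Type*} [Field K] [Field L] [Algebra K L] [LinearOrderedCommGroupWithZero Γ]
  (v : Valuation L Γ) [FiniteDimensional K L] [IsGalois K L] {p : ℕ}

/-- The residues of the conjugates are ξ + n with n in the prime field. These are the roots of X ^ p
- X - (ξ ^ p - ξ), which is therefore the reduced characteristic polynomial and has coefficients in
Kν. -/
lemma exists_pow_sub_self_eq (hv : ∀ (σ : L ≃ₐ[K] L) (y : L), v (σ y) = v y)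
    (hp : p.Prime) (hdeg : Module.finrank K L = p) [CharP (residue (restr K v)) p]
    (x : v.valuationSubring) {τ : L ≃ₐ[K] L} (hτ : v (τ x - x - 1) < 1) :
    ∃ b : residue (restr K v), IsLocalRing.residue v.valuationSubring x ^ p -
      IsLocalRing.residue v.valuationSubring x = algebraMap _ (residue v) b := by
  obtain ⟨q, hqm, hqd, hq⟩ := exists_monic_residue_map_eq_prod v hv hdeg x
  have : CharP (residue v) p :=
    charP_of_injective_algebraMap (algebraMap (residue (restr K v)) (residue v)).injective p
  have : Fact p.Prime := ⟨hp⟩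
  have hcard : Nat.card (L ≃ₐ[K] L) = p := by rw [← hdeg, IsGalois.card_aut_eq_finrank]
  set ξ := IsLocalRing.residue v.valuationSubring x with hξ
  have hτ1 : τ ∉ residueStabilizer v hv (x : L) := by
    rw [mem_residueStabilizer]
    intro h
    have := v.map_sub_lt h hτ
    simp at this
  have hstab : residueStabilizer v hv (x : L) = ⊥ := by
    have : Fact (Nat.card (L ≃ₐ[K] L)).Prime := ⟨by rw [hcard]; exact hp⟩
    exact (Subgroup.eq_bot_or_eq_top_of_prime_card _).resolve_right
      fun h => hτ1 (h ▸ Subgroup.mem_top τ)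
  have hτne : τ ≠ 1 := fun h => hτ1 (h ▸ Subgroup.one_mem _)
  have hpow : ∀ n : ℕ, v ((τ ^ n) x - x - n) < 1 := by
    intro n
    induction n with
    | zero => simp
    | succ n ih =>
      have h : (τ ^ (n + 1)) (x : L) - x - (n + 1 : ℕ) =
          τ ((τ ^ n) x - x - n) + (τ x - x - 1) := by
        rw [pow_succ', AlgEquiv.mul_apply, map_sub, map_sub, map_natCast]
        push_cast
        ring
      rw [h]
      exact v.map_add_lt (by rw [hv]; exact ih) hτ
  let f : (L ≃ₐ[K] L) → residue v := fun σ =>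
    IsLocalRing.residue v.valuationSubring ⟨σ x, (hv σ x).le.trans x.2⟩
  have hf : Function.Injective f := by
    intro σ ρ h
    have h1 := (residue_eq_iff v _ _).1 h
    have h2 : ρ⁻¹ * σ ∈ residueStabilizer v hv (x : L) := by
      rw [mem_residueStabilizer, ← hv ρ, map_sub, ← AlgEquiv.mul_apply, mul_inv_cancel_left]
      exact h1
    rw [hstab, Subgroup.mem_bot, inv_mul_eq_one] at h2
    exact h2.symm
  have hfn : ∀ σ, ∃ n : ℕ, f σ = ξ + n := by
    intro σ
    obtain ⟨n, rfl⟩ := mem_powers_of_prime_card (p := p) (g' := σ) hcard hτne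
    refine ⟨n, ?_⟩
    rw [hξ, ← map_natCast (IsLocalRing.residue v.valuationSubring), ← map_add]
    refine (residue_eq_iff v _ _).2 ?_
    have := hpow n
    rw [sub_sub] at this
    exact this
  -- the conjugates are the roots of the Artin-Schreier polynomial of the residue
  have hdeg1 : (X + C (ξ ^ p - ξ)).natDegree < p := by
    rw [natDegree_X_add_C]; exact hp.one_lt
  have hAm : (X ^ p - (X + C (ξ ^ p - ξ))).Monic :=
    monic_X_pow_sub (by
      rw [degree_X_add_C]; exact_mod_cast hp.one_lt)
  have hAd : (X ^ p - (X + C (ξ ^ p - ξ))).natDegree = p := by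
    rw [natDegree_sub_eq_left_of_natDegree_lt (by rwa [natDegree_X_pow]), natDegree_X_pow]
  have hdvd : ∏ σ, (X - C (f σ)) ∣ X ^ p - (X + C (ξ ^ p - ξ)) := by
    refine Finset.prod_dvd_of_coprime ?_ ?_
    · exact (pairwise_coprime_X_sub_C hf).set_pairwise _
    · intro σ _
      rw [dvd_iff_isRoot, IsRoot]
      obtain ⟨n, hn⟩ := hfn σ
      have hfr : (n : residue v) ^ p = n := map_natCast (frobenius (residue v) p) n
      simp only [eval_sub, eval_pow, eval_X, eval_add, eval_C, hn]
      rw [add_pow_char, hfr]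
      ring
  have hprod : X ^ p - (X + C (ξ ^ p - ξ)) =
      q.map (algebraMap (residue (restr K v)) (residue v)) := by
    refine eq_of_monic_of_dvd_of_natDegree_le (hqm.map _) hAm (hq ▸ hdvd) ?_
    rw [hAd, natDegree_map, hqd]
  refine ⟨-q.coeff 0, ?_⟩
  rw [map_neg, ← coeff_map, ← hprod, coeff_zero_eq_eval_zero]
  simp [zero_pow hp.ne_zero]

end ArtinSchreier

/-! ### Kummer generators and their best approximations -/

section Generators

variable {K L Γ : Type*} [Field K] [Field L] [Algebra K L] [LinearOrderedCommGroupWithZero Γ]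
  (v : Valuation L Γ) {p : ℕ} {θ : L}

lemma IsKummerGenerator.div (hθ : IsKummerGenerator p K θ) {c : K} (hc : c ≠ 0) :
    IsKummerGenerator p K (θ / algebraMap K L c) := by
  obtain ⟨⟨a, ha⟩, hne, htop⟩ := hθ
  have hc' : algebraMap K L c ≠ 0 := (_root_.map_ne_zero _).2 hc
  refine ⟨⟨a / c ^ p, by rw [div_pow, ha, map_div₀, map_pow]⟩, fun e he => hne (e * c) ?_, ?_⟩
  · rw [map_mul, ← he, div_mul_cancel₀ _ hc']
  · rw [eq_top_iff, ← htop, IntermediateField.adjoin_simple_le_iff]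
    have h := mul_mem (IntermediateField.mem_adjoin_simple_self K (θ / algebraMap K L c))
      (algebraMap_mem K⟮θ / algebraMap K L c⟯ c)
    rwa [div_mul_cancel₀ _ hc'] at h

lemma isLeast_valueSet_div {γ δ : Γˣ} (hγ : IsLeast (valueSet K v θ) γ) {c : K}
    (hδ : v (algebraMap K L c) = δ) :
    IsLeast (valueSet K v (θ / algebraMap K L c)) (γ / δ) := by
  have hc : algebraMap K L c ≠ 0 := by
    rw [← v.ne_zero_iff, hδ]; exact δ.ne_zero
  constructor
  · obtain ⟨e, he⟩ := hγ.1
    refine ⟨e / c, ?_⟩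
    rw [map_div₀, ← sub_div, map_div₀, he, hδ, Units.val_div_eq_div_val]
  · rintro ε ⟨e, he⟩
    rw [div_le_iff_le_mul]
    refine hγ.2 ⟨e * c, ?_⟩
    have h : θ - algebraMap K L (e * c) =
        (θ / algebraMap K L c - algebraMap K L e) * algebraMap K L c := by
      rw [sub_mul, div_mul_cancel₀ _ hc, map_mul]
    rw [h, map_mul, he, hδ, Units.val_mul]

/-- If the least distance from `θ` to `K` is attained and is a value of `K`, then it gives rise to
a residue outside the residue field of `K`. -/
lemma residue_ne_of_isLeast (hθ : ∀ c : K, θ ≠ algebraMap K L c) {γ : Γˣ} (hγ : IsLeast (valueSet K v θ) γ) {c d : K}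
    (hc : v (θ - algebraMap K L c) = γ) (hd : v (algebraMap K L d) = γ) :
    ∃ h : v ((θ - algebraMap K L c) / algebraMap K L d) ≤ 1,
      ∀ e, IsLocalRing.residue v.valuationSubring ⟨_, h⟩ ≠
        algebraMap (residue (restr K v)) (residue v) e := by
  have hd0 : algebraMap K L d ≠ 0 := by
    rw [← v.ne_zero_iff, hd]; exact γ.ne_zero
  have h1 : v ((θ - algebraMap K L c) / algebraMap K L d) ≤ 1 := by
    rw [map_div₀, hc, hd, div_self γ.ne_zero]
  refine ⟨h1, fun e he => ?_⟩
  obtain ⟨e, rfl⟩ := IsLocalRing.residue_surjective e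
  rw [Valuation.HasExtension.algebraMap_residue_eq_residue_algebraMap, residue_eq_iff] at he
  change v ((θ - algebraMap K L c) / algebraMap K L d - algebraMap K L e) < 1 at he
  -- If `e` had the residue of (θ - c)/d, then c + d * e would be strictly closer to θ than `c`.
  have heq : θ - algebraMap K L (c + d * e) =
      ((θ - algebraMap K L c) / algebraMap K L d - algebraMap K L e) * algebraMap K L d := by
    rw [sub_mul, div_mul_cancel₀ _ hd0, map_add, map_mul]; ring
  have hlt : v (θ - algebraMap K L (c + d * e)) < γ := by
    rw [heq, map_mul, hd]
    exact mul_lt_of_lt_one_left (zero_lt_iff.2 γ.ne_zero) he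
  have hne : v (θ - algebraMap K L (c + d * e)) ≠ 0 := by
    rw [v.ne_zero_iff, sub_ne_zero]
    exact hθ _
  exact (hγ.2 ⟨_, (Units.val_mk0 hne).symm⟩).not_gt (by rwa [← Units.val_lt_val, Units.val_mk0])

/-- The distances of a Kummer generator of value `1` are bounded by that of two conjugates. -/
lemma map_one_sub_le_of_isLeast (hv : ∀ (σ : L ≃ₐ[K] L) (y : L), v (σ y) = v y)
    (h1 : v θ = 1) {γ : Γˣ}
    (hγ : IsLeast (valueSet K v θ) γ) {z : L} {τ : L ≃ₐ[K] L} (hτ : τ θ = z * θ) :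
    v (1 - z) ≤ γ := by
  obtain ⟨c, hc⟩ := hγ.1
  have h : (1 - z) * θ = (θ - algebraMap K L c) - τ (θ - algebraMap K L c) := by
    rw [map_sub, hτ, AlgEquiv.commutes]; ring
  calc v (1 - z) = v ((1 - z) * θ) := by rw [map_mul, h1, mul_one]
    _ ≤ γ := by
      rw [h]
      exact v.map_sub_le hc.le (by rw [hv]; exact hc.le)

end Generators

/-! ### The immediate, purely wild and unramified cases -/

section Classification

variable {K L Γ : Type*} [Field K] [Field L] [Algebra K L] [LinearOrderedCommGroupWithZero Γ]
  (v : Valuation L Γ) [FiniteDimensional K L] [IsGalois K L] {p : ℕ}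
  (hv : ∀ (σ : L ≃ₐ[K] L) (y : L), v (σ y) = v y)
  (hp : p.Prime) (hdeg : Module.finrank K L = p) [CharP (residue (restr K v)) p]

include hv hp hdeg

/-- A new value or a new residue would provide a valuation basis of powers, and with it a best
approximation of θ. -/
lemma isImmediate_of_not_exists_isLeast {θ : L} (hθ : ∀ c : K, θ ≠ algebraMap K L c)
    (h : ¬ ∃ γ : Γˣ, IsLeast (valueSet K v θ) γ) : IsImmediate K v := by
  constructor
  · refine le_antisymm (fun g hgL => ?_) (vGroup_restr_le K v)
    by_contra hgK
    obtain ⟨x, hg⟩ := (mem_vGroup_iff v).1 hgL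
    exact h (exists_isLeast_valueSet v hθ
      (fun R hR i => map_coeff_le_map_aeval_of_ramified v hg hp
        (pow_mem_vGroup_restr v hv hdeg hgL) hgK hdeg hR i)
      (exists_eq_aeval_of_prime_degree hp hdeg (ne_algebraMap_of_ramified v hg hgK) θ))
  · by_contra hs
    obtain ⟨ω, hω⟩ := not_forall.1 hs
    obtain ⟨x, rfl⟩ := IsLocalRing.residue_surjective ω
    have hx : ∀ c, IsLocalRing.residue v.valuationSubring x ≠
        algebraMap (residue (restr K v)) (residue v) c := fun c hc => hω ⟨c, hc.symm⟩
    exact h (exists_isLeast_valueSet v hθ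
      (fun R hR i => map_coeff_le_map_aeval v x
        (natDegree_minpoly_residue v hv hp hdeg x hx).2.ge hR i)
      (exists_eq_aeval_of_prime_degree hp hdeg (ne_algebraMap_of_residue_ne v hx) θ))

lemma isPurelyWild_isDefectless_of_lt {θ : L} (hθ : ∀ c : K, θ ≠ algebraMap K L c)
    (h1 : v θ = 1) {γ : Γˣ} (hγ : IsLeast (valueSet K v θ) γ) (hγK : γ ∈ vGroup (restr K v))
    {z : L} {τ : L ≃ₐ[K] L} (hτ1 : τ ≠ 1) (hτ : τ θ = z * θ) (hz : v (1 - z) < γ) :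
    IsPurelyWild K v p ∧ IsDefectless K v := by
  obtain ⟨c, hc⟩ := hγ.1
  obtain ⟨d, hd⟩ := (mem_vGroup_restr_iff K v).1 hγK
  obtain ⟨hle, hx⟩ := residue_ne_of_isLeast v hθ hγ hc hd
  refine ⟨isPurelyWild_of_residue_ne v hv hp hdeg hx ?_, isDefectless_of_residue_ne v hv hp hdeg hx⟩
  have : Fact (Nat.card (L ≃ₐ[K] L)).Prime :=
    ⟨by rw [IsGalois.card_aut_eq_finrank, hdeg]; exact hp⟩
  -- The element (θ - c)/d is moved by (ζ - 1)θ/d, of value below 1. Since the group has prime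
  -- order, the nontrivial τ lying in the stabilizer makes it the whole group.
  have hmem : τ ∈ residueStabilizer v hv ((θ - algebraMap K L c) / algebraMap K L d) := by
    rw [mem_residueStabilizer]
    have h : τ ((θ - algebraMap K L c) / algebraMap K L d) -
        (θ - algebraMap K L c) / algebraMap K L d = -((1 - z) * θ / algebraMap K L d) := by
      rw [map_div₀, map_sub, hτ, AlgEquiv.commutes, AlgEquiv.commutes]; ring
    rw [h, Valuation.map_neg, map_div₀, map_mul, h1, mul_one, hd]
    exact (div_lt_one₀ (zero_lt_iff.2 γ.ne_zero)).2 hz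
  have htop := (Subgroup.eq_bot_or_eq_top_of_prime_card
    (residueStabilizer v hv ((θ - algebraMap K L c) / algebraMap K L d))).resolve_left
    fun h => hτ1 (by rwa [h, Subgroup.mem_bot] at hmem)
  intro σ
  have : σ ∈ residueStabilizer v hv ((θ - algebraMap K L c) / algebraMap K L d) :=
    htop ▸ Subgroup.mem_top σ
  exact this

lemma isUnramified_isArtinSchreierExtension_of_eq {θ : L} (hθ : ∀ c : K, θ ≠ algebraMap K L c)
    (h1 : v θ = 1) {γ : Γˣ} (hγ : IsLeast (valueSet K v θ) γ)
    {ζ : K} {τ : L ≃ₐ[K] L} (hτ : τ θ = algebraMap K L ζ * θ)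
    (hζ : v (1 - algebraMap K L ζ) = γ) (hγ1 : (γ : Γ) < 1) :
    IsDefectless K v ∧ IsUnramified K v p ∧
      IsArtinSchreierExtension p (residue (restr K v)) (residue v) := by
  obtain ⟨c, hc⟩ := hγ.1
  have hvc : v (algebraMap K L c) = 1 := by
    rw [← h1]
    refine v.map_eq_of_sub_lt ?_
    rw [v.map_sub_swap, hc, h1]
    exact hγ1
  have hc0 : algebraMap K L c ≠ 0 := by
    rw [← v.ne_zero_iff, hvc]; exact one_ne_zero
  have hζ0 : 1 - algebraMap K L ζ ≠ 0 := by
    rw [← v.ne_zero_iff, hζ]; exact γ.ne_zero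
  have hdL : algebraMap K L (c * (ζ - 1)) = algebraMap K L c * (algebraMap K L ζ - 1) := by
    rw [map_mul, map_sub, map_one]
  -- The scaling factor c(ζ - 1) has the right value, and it is chosen so that τ moves the quotient
  -- by θ/c = 1 + (θ - c)/c, which has residue 1.
  have hd : v (algebraMap K L (c * (ζ - 1))) = γ := by
    rw [hdL, map_mul, hvc, one_mul, v.map_sub_swap, hζ]
  obtain ⟨hle, hx⟩ := residue_ne_of_isLeast v hθ hγ hc hd
  have hζ0' : algebraMap K L ζ - 1 ≠ 0 := by rwa [← neg_ne_zero, neg_sub]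
  have hmove : τ ((θ - algebraMap K L c) / algebraMap K L (c * (ζ - 1))) -
      (θ - algebraMap K L c) / algebraMap K L (c * (ζ - 1)) - 1 =
        (θ - algebraMap K L c) / algebraMap K L c := by
    rw [map_div₀, map_sub, hτ, AlgEquiv.commutes, AlgEquiv.commutes, hdL]
    field_simp
    ring
  obtain ⟨b, hb⟩ := exists_pow_sub_self_eq v hv hp hdeg ⟨_, hle⟩ (τ := τ) (by
    change v (τ ((θ - algebraMap K L c) / algebraMap K L (c * (ζ - 1))) -
      (θ - algebraMap K L c) / algebraMap K L (c * (ζ - 1)) - 1) < 1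
    rw [hmove, map_div₀, hc, hvc, div_one]
    exact hγ1)
  have hsep := isSeparable_residue v hv hp hdeg hx
    (isSeparable_of_pow_sub_self_eq (p := p) hb)
  exact ⟨isDefectless_of_residue_ne v hv hp hdeg hx,
    isUnramified_of_isSeparable v hp (vGroup_eq_of_residue_ne v hv hp hdeg hx),
    inferInstance, _, ⟨b, hb⟩, hx, adjoin_residue_eq_top v hv hp hdeg hx⟩

end Classification

lemma map_natCast_lt_one {K L Γ : Type*} [Field K] [Field L] [Algebra K L]
    [LinearOrderedCommGroupWithZero Γ] (v : Valuation L Γ) (p : ℕ)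
    [CharP (residue (restr K v)) p] : v (p : L) < 1 := by
  have h : IsLocalRing.residue (restr K v).valuationSubring
      (p : (restr K v).valuationSubring) = 0 := by
    rw [map_natCast]; exact CharP.cast_eq_zero _ p
  rw [residue_eq_zero_iff] at h
  simpa using h

end KummerVal

/-! ### The theorem -/

theorem theorem3p13 {K L Γ : Type*} [Field K] [Field L] [Algebra K L]
    [LinearOrderedCommGroupWithZero Γ] (v : Valuation L Γ) (p : ℕ) (hp : p.Prime)
    (hhens : HenselianLocalRing (KummerVal.restr K v).valuationSubring)
    (hchar : CharZero K) (hres : CharP (KummerVal.residue (KummerVal.restr K v)) p)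
    (hroot : ∃ ζ : K, IsPrimitiveRoot ζ p)
    (θ : L) (hθ : KummerVal.IsKummerGenerator p K θ) :
    -- case I
    ((¬ ∃ γ : Γˣ, IsLeast (KummerVal.valueSet K v θ) γ) → KummerVal.IsImmediate K v) ∧
    -- case II
    (∀ γ : Γˣ, IsLeast (KummerVal.valueSet K v θ) γ →
      -- case II.A
      (γ ∉ KummerVal.vGroup (KummerVal.restr K v) →
        KummerVal.IsPurelyWild K v p ∧ KummerVal.IsDefectless K v) ∧
      -- case II.B
      (γ ∈ KummerVal.vGroup (KummerVal.restr K v) →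
        -- the generator can be chosen with value zero, still in case II.B
        (∃ (θ' : L) (γ' : Γˣ), KummerVal.IsKummerGenerator p K θ' ∧ v θ' = 1 ∧
          IsLeast (KummerVal.valueSet K v θ') γ' ∧
          γ' ∈ KummerVal.vGroup (KummerVal.restr K v)) ∧
        -- the classification for every such choice
        (∀ (θ' : L) (γ' : Γˣ), KummerVal.IsKummerGenerator p K θ' → v θ' = 1 →
          IsLeast (KummerVal.valueSet K v θ') γ' →
          γ' ∈ KummerVal.vGroup (KummerVal.restr K v) →
          -- `0 ≤ γ'` and `(p - 1) γ' ≤ ν p`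
          ((γ' : Γ) ≤ 1 ∧ v (p : L) ≤ (γ' : Γ) ^ (p - 1)) ∧
          -- case II.B.1: `(p - 1) γ' < ν p`
          (v (p : L) < (γ' : Γ) ^ (p - 1) →
            KummerVal.IsPurelyWild K v p ∧ KummerVal.IsDefectless K v) ∧
          -- case II.B.2: `(p - 1) γ' = ν p`
          (v (p : L) = (γ' : Γ) ^ (p - 1) →
            KummerVal.IsDefectless K v ∧ KummerVal.IsUnramified K v p ∧
            KummerVal.IsArtinSchreierExtension p
              (KummerVal.residue (KummerVal.restr K v)) (KummerVal.residue v))))) := by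
  obtain ⟨ζ, hζ⟩ := hroot
  obtain ⟨hfin, hgal, hdeg, -⟩ := hθ.isGalois hp hζ
  have hv := KummerVal.map_algEquiv_eq v hp hdeg hhens
  have hz := hζ.map_of_injective (algebraMap K L).injective
  have hzp := KummerVal.map_one_sub_pow_sub_one v hp hz
  have hp1 : p - 1 ≠ 0 := by have := hp.two_le; omega
  refine ⟨KummerVal.isImmediate_of_not_exists_isLeast v hv hp hdeg hθ.2.1, fun γ hγ =>
    ⟨fun hγK => ?_, fun hγK => ⟨?_, fun θ' γ' hθ' h1 hγ' hγ'K => ?_⟩⟩⟩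
  · obtain ⟨c, hc⟩ := hγ.1
    have hγp := KummerVal.pow_mem_vGroup_restr v hv hdeg ((KummerVal.mem_vGroup_iff v).2 ⟨_, hc⟩)
    exact ⟨KummerVal.isPurelyWild_of_ramified v hc hp hγp hγK hdeg hv,
      KummerVal.isDefectless_of_ramified v hc hp hγp hγK hdeg⟩
  -- The value of θ lies in the value group of `K`: either 0 is already a best approximation, or a
  -- closer `c` has the same value as θ. Dividing by an element of this value normalises θ.
  · obtain ⟨d, δ, hdδ, hθδ⟩ : ∃ (d : K) (δ : Γˣ), v (algebraMap K L d) = δ ∧ v θ = δ := by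
      have hθ0 : v θ ≠ 0 := v.ne_zero_iff.2 fun h => hθ.2.1 0 (by rw [h, map_zero])
      obtain ⟨c, hc⟩ := hγ.1
      have hle : (γ : Γ) ≤ v θ := by
        have := hγ.2 ⟨0, by rw [map_zero, sub_zero, Units.val_mk0 hθ0]⟩
        rwa [← Units.val_le_val, Units.val_mk0] at this
      rcases hle.eq_or_lt with h | h
      · obtain ⟨d, hd⟩ := (KummerVal.mem_vGroup_restr_iff K v).1 hγK
        exact ⟨d, γ, hd, h.symm⟩
      · refine ⟨c, Units.mk0 _ hθ0, ?_, rfl⟩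
        refine v.map_eq_of_sub_lt ?_
        rwa [v.map_sub_swap, hc]
    have hd0 : d ≠ 0 := by
      rintro rfl
      rw [map_zero, map_zero] at hdδ
      exact δ.ne_zero hdδ.symm
    refine ⟨_, _, hθ.div hd0, ?_, KummerVal.isLeast_valueSet_div v hγ hdδ, ?_⟩
    · rw [map_div₀, hdδ, hθδ, div_self δ.ne_zero]
    · exact div_mem hγK ((KummerVal.mem_vGroup_restr_iff K v).2 ⟨d, hdδ⟩)
  · obtain ⟨-, -, -, τ, hτ⟩ := hθ'.isGalois hp hζ
    have hτ1 : τ ≠ 1 := by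
      rintro rfl
      have hθ0 : θ' ≠ 0 := fun h => hθ'.2.1 0 (by rw [h, map_zero])
      exact hz.ne_one hp.one_lt (mul_right_cancel₀ hθ0 (by rw [one_mul, ← hτ]; rfl))
    have hzγ := KummerVal.map_one_sub_le_of_isLeast v hv h1 hγ' hτ
    refine ⟨⟨?_, ?_⟩, fun hlt => ?_, fun heq => ?_⟩
    · have : γ' ≤ 1 := hγ'.2 ⟨0, by rw [map_zero, sub_zero, h1, Units.val_one]⟩
      exact_mod_cast this
    · rw [← hzp]
      exact pow_le_pow_left' hzγ _
    · rw [← hzp] at hlt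
      exact KummerVal.isPurelyWild_isDefectless_of_lt v hv hp hdeg hθ'.2.1 h1 hγ' hγ'K hτ1 hτ
        (lt_of_pow_lt_pow_left' _ hlt)
    -- As `p` vanishes in the residue field, equality gives γ' < 1, which is needed for `c` to be a
    -- unit close to θ'.
    · have hlt := KummerVal.map_natCast_lt_one (K := K) v p
      rw [heq] at hlt
      rw [← hzp] at heq
      exact KummerVal.isUnramified_isArtinSchreierExtension_of_eq v hv hp hdeg hθ'.2.1 h1 hγ' hτ
        ((pow_left_inj₀ zero_le zero_le hp1).1 heq)
        (lt_of_pow_lt_pow_left' (p - 1) (by rwa [one_pow]))
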